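/- Let $k$ be an algebraically closed field of characteristic zero, let $X$ be a normal variety over $k$ (a normal, separated, integral scheme of finite type over $k$) with generic point $\eta$ and function field $K$, and let $\operatorname{Div}(X)$ be its group of Weil divisors, ordered coefficientwise; put $\operatorname{div}(0)=\infty$. For a reflexive coherent sheaf $\mathcal{F}$ on $X$, viewed as a subsheaf of the constant sheaf $\mathcal{F}_\eta$, and $0\neq e\in\mathcal{F}_\eta$, let $\mathcal{W}_{\mathcal F}(e)\in\operatorname{Div}(X)$ be the unique Weil divisor $D$ such that $\mathcal{O}_X(D)\cdot e=(K\cdot e)\cap\mathcal{F}$, where $\mathcal{O}_X(D)(U)=\{f\in K^*\mid (D+\operatorname{div}(f))|_U\geq 0\}\cup\{0\}$ for nonempty open $U\subseteq X$; put $\mathcal{W}_{\mathcal F}(0)=\infty$. This is the Weil decoration of $\mathcal F$. Let $\mathcal{E}$ be a reflexive coherent sheaf on $X$ with dual $\mathcal{E}^\vee=\mathcal{H}om_{\mathcal{O}_X}(\mathcal{E},\mathcal{O}_X)$. Then the divisors defining $\mathcal{W}_{\mathcal{E}}$ and $\mathcal{W}_{\mathcal{E}^\vee}$ exist and are unique,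 there is a canonical isomorphism $(\mathcal{E}^\vee)_\eta\cong(\mathcal{E}_\eta)^\vee$ of $K$-vector spaces (sending the germ of a local homomorphism to the linear form it induces), and under it, for every $\varphi\in(\mathcal{E}_\eta)^\vee$, \[ \mathcal{W}_{\mathcal{E}^\vee}(\varphi)=\bigwedge_{0\neq v\in\mathcal{E}_\eta}\bigl(\operatorname{div}(\varphi(v))-\mathcal{W}_{\mathcal{E}}(v)\bigr), \] the greatest lower bound in $\operatorname{Div}(X)\cup\{\infty\}$. For $\varphi\neq0$ this meet is a well-defined divisor formed coefficientwise: for every prime divisor $P$, the minimum of the integers $\operatorname{div}(\varphi(v))_P-\mathcal{W}_{\mathcal{E}}(v)_P$ over all $v\in\mathcal{E}_\eta$ with $\varphi(v)\neq0$ exists and equals $\mathcal{W}_{\mathcal{E}^\vee}(\varphi)_P$, and it is zero for all but finitely many $P$. -/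

import Mathlib

universe u

open CategoryTheory AlgebraicGeometry

namespace WeilDeco

open TopologicalSpace Opposite

noncomputable section

/-- A normal algebraic variety over the field `k`: an integral, separated scheme of finite type
over `k` all of whose local rings are integrally closed domains. -/
structure NormalVariety (k : Type u) [Field k] where
  X : Scheme.{u}
  str : X ⟶ Spec (CommRingCat.of k)
  isIntegral : IsIntegral X
  isSeparated : IsSeparated str
  locallyOfFiniteType : LocallyOfFiniteType str
  quasiCompact : QuasiCompact str
  isIntegrallyClosed_stalk : ∀ x : X, IsIntegrallyClosed (X.presheaf.stalk x)

namespace NormalVariety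
variable {k : Type u} [Field k] (X : NormalVariety k)

instance : IsIntegral X.X := X.isIntegral

instance : IsNoetherian X.X := by
  have := X.locallyOfFiniteType
  have := X.quasiCompact
  have h1 : IsLocallyNoetherian X.X := LocallyOfFiniteType.isLocallyNoetherian X.str
  have h2 : CompactSpace X.X := QuasiCompact.compactSpace_of_compactSpace X.str
  exact { }

end NormalVariety

/-- Prime divisors of `X`, identified with their generic points, that is, with the points of
codimension one (`Order.coheight` refers to the specialization order on `X`). -/
abbrev PrimeDivisor (X : Scheme.{u}) : Type u := {P : X // Order.coheight P = 1}

/-- The group `Div(X)` of Weil divisors of a Noetherian scheme: finite formal integral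
combinations of prime divisors. It is ordered coefficientwise. -/
abbrev WeilDivisor (X : Scheme.{u}) : Type u := PrimeDivisor X →₀ ℤ

section Divisors

variable {X : Scheme.{u}} [IsIntegral X] [IsNoetherian X]

/-- Only finitely many prime divisors lie in the complement of a nonempty open set. -/
theorem finite_primeDivisor_not_mem (U : X.Opens) (hU : (U : Set X).Nonempty) :
    {P : PrimeDivisor X | P.1 ∉ U}.Finite := by
  have : NoetherianSpace X := inferInstance
  let Z : Set X := (U : Set X)ᶜ
  have hZ : IsClosed Z := U.isOpen.isClosed_compl
  obtain ⟨S, hS, hS'⟩ := NoetherianSpace.exists_finite_set_isClosed_irreducible hZ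
  obtain ⟨hSc, hSi, hSe⟩ := hS'
  have hη : genericPoint X ∈ U :=
    ((genericPoint_spec X).mem_open_set_iff U.isOpen).mpr (by simpa using hU)
  refine Set.Finite.of_finite_image (f := fun P : PrimeDivisor X => closure {P.1}) ?_ ?_
  · refine hS.subset ?_
    rintro _ ⟨P, hP, rfl⟩
    have : P.1 ∈ Z := hP
    rw [hSe] at this
    obtain ⟨T, hT, hPT⟩ := this
    have hTi := hSi T hT
    have hTc := hSc T hT
    obtain ⟨z, hz⟩ := QuasiSober.sober hTi hTc
    have hzP : z ⤳ P.1 := hz.specializes hPT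
    have hzZ : z ∈ Z := by
      rw [hSe]; exact ⟨T, hT, hz.mem⟩
    have hPz : P.1 ⤳ z := by
      by_contra hcon
      have h1 : P.1 < z := lt_of_le_not_ge hzP hcon
      have h2 : z < genericPoint X := by
        refine lt_of_le_not_ge ((genericPoint_spec X).specializes trivial) ?_
        intro h
        have : z ∈ U := h.mem_open U.isOpen hη
        exact hzZ this
      have h3 := Order.coheight_add_one_le h1
      have h4 := Order.coheight_add_one_le h2
      rw [P.2] at h3
      have : (1:ℕ∞) + 1 ≤ 1 := le_trans (by gcongr; exact le_trans (by simp) h4) h3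
      exact absurd this (by decide)
    have : P.1 = z := (hPz.antisymm hzP).eq
    change closure {P.1} ∈ S
    rw [this, hz.def]; exact hT
  · intro P _ Q _ h
    apply Subtype.ext
    exact IsGenericPoint.eq (isGenericPoint_closure) (by rw [IsGenericPoint]; exact h.symm)

theorem finite_support_ord (f : X.functionField) :
    (Function.support fun P : PrimeDivisor X => Scheme.ord f P.1).Finite := by
  by_cases hf : f = 0
  · subst hf; simp [Function.support]
  obtain ⟨U, hU, s, rfl⟩ := X.presheaf.exists_germ_eq f
  have hne : Nonempty U := ⟨⟨_, hU⟩⟩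
  have hs : s ≠ 0 := by rintro rfl; simp at hf
  refine (finite_primeDivisor_not_mem (X.basicOpen s) ?_).subset ?_
  · rw [Set.nonempty_iff_ne_empty]
    intro h
    apply hs
    apply (basicOpen_eq_bot_iff s).mp
    exact SetLike.coe_injective h
  · intro P hP hPU
    apply hP
    have hle := X.basicOpen_le s
    have : Nonempty (X.basicOpen s) := ⟨⟨_, hPU⟩⟩
    have h1 := Scheme.ord_of_isUnit (X := X) (U := X.basicOpen s)
      (f := X.presheaf.map (homOfLE hle).op s)
      (RingedSpace.isUnit_res_basicOpen X.toRingedSpace s) hPU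
    rw [← h1]
    exact congrArg (fun g : X.functionField => Scheme.ord g P.1)
      (X.presheaf.germ_res_apply (homOfLE hle) _ _ s).symm

/-- The divisor `div(f)` of a nonzero rational function (with value `0` at `f = 0`; the convention
`div(0) = ∞` is implemented in `divTop`). -/
def div (f : X.functionField) : WeilDivisor X :=
  Finsupp.ofSupportFinite (fun P => Scheme.ord f P.1) (finite_support_ord f)

/-- `div(f)` as an element of `Div(X) ∪ {∞}`, with `div(0) = ∞`. -/
def divTop (f : X.functionField) : WithTop (WeilDivisor X) :=
  open Classical in if f = 0 then ⊤ else ((div f : WeilDivisor X) : WithTop (WeilDivisor X))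

/-- The sections `𝒪_X(D)(U) = {f ∈ K^* | (D + div(f))|_U ≥ 0} ∪ {0}`. -/
def sectionsOfDivisor (D : WeilDivisor X) (U : X.Opens) : Set X.functionField :=
  {f | f ≠ 0 → ∀ P : PrimeDivisor X, P.1 ∈ U → 0 ≤ (D + div f) P}

end Divisors

section Dual
variable {X : Scheme.{u}} (E : X.Modules)

/-- `Hom_{𝒪_U}(E|_U, 𝒪_U)`: families of `𝒪_X(V)`-linear maps `E(V) → 𝒪_X(V)`, for `V ⊆ U` open,
that are compatible with the restriction maps. -/
def DualSection (U : X.Opens) :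
    AddSubgroup (∀ V : {V : X.Opens // V ≤ U}, Γ(E, V.1) →ₗ[Γ(X, V.1)] Γ(X, V.1)) where
  carrier := {s | ∀ (V W : {V : X.Opens // V ≤ U}) (h : W.1 ≤ V.1) (m : Γ(E, V.1)),
    s W (E.presheaf.map (homOfLE h).op m) = X.presheaf.map (homOfLE h).op (s V m)}
  add_mem' hs ht V W h m := by simp [hs V W h m, ht V W h m]
  zero_mem' V W h m := by simp
  neg_mem' hs V W h m := by simp [hs V W h m]

/-- `𝒪_X(U)` acts on `Hom_{𝒪_U}(E|_U, 𝒪_U)` by restricting and multiplying values. -/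
instance (U : X.Opens) : SMul Γ(X, U) (DualSection E U) where
  smul r s := ⟨fun V => X.presheaf.map (homOfLE V.2).op r • s.1 V, by
    intro V W h m
    have := s.2 V W h m
    simp only [LinearMap.smul_apply, smul_eq_mul, map_mul, this]
    congr 1
    rw [← CommRingCat.comp_apply, ← Functor.map_comp]
    rfl⟩

theorem DualSection.smul_apply {U : X.Opens} (r : Γ(X, U)) (s : DualSection E U)
    (V : {V : X.Opens // V ≤ U}) :
    (r • s).1 V = X.presheaf.map (homOfLE V.2).op r • s.1 V := rfl

instance (U : X.Opens) : Module Γ(X, U) (DualSection E U) where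
  one_smul s := Subtype.ext <| funext fun V => by simp [DualSection.smul_apply]
  mul_smul r t s := Subtype.ext <| funext fun V => by simp [DualSection.smul_apply, mul_smul]
  smul_zero r := Subtype.ext <| funext fun V => by simp [DualSection.smul_apply]
  smul_add r s t := Subtype.ext <| funext fun V => by simp [DualSection.smul_apply]
  add_smul r t s := Subtype.ext <| funext fun V => by simp [DualSection.smul_apply, add_smul]
  zero_smul s := Subtype.ext <| funext fun V => by simp [DualSection.smul_apply]

/-- Restriction of homomorphisms to a smaller open set. -/
def DualSection.restrict {U V : X.Opens} (h : V ≤ U) : DualSection E U →+ DualSection E V where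
  toFun s := ⟨fun W => s.1 ⟨W.1, W.2.trans h⟩, fun W W' h' m =>
    s.2 ⟨W.1, W.2.trans h⟩ ⟨W'.1, W'.2.trans h⟩ h' m⟩
  map_zero' := rfl
  map_add' _ _ := rfl

/-- The presheaf of abelian groups `U ↦ Hom_{𝒪_U}(E|_U, 𝒪_U)`. -/
def dualPresheaf : TopCat.Presheaf Ab.{u} X where
  obj U := AddCommGrpCat.of (DualSection E U.unop)
  map f := AddCommGrpCat.ofHom (DualSection.restrict E f.unop.le)

instance (U : (Opens X)ᵒᵖ) : Module (X.ringCatSheaf.obj.obj U) ((dualPresheaf E).obj U) :=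
  inferInstanceAs (Module Γ(X, U.unop) (DualSection E U.unop))

theorem eq_of_eq_on_cover {ι : Type*} (U : ι → X.Opens) {V : X.Opens} (hV : V ≤ iSup U)
    (x y : Γ(X, V))
    (h : ∀ i, X.presheaf.map (homOfLE (inf_le_left : V ⊓ U i ≤ V)).op x =
      X.presheaf.map (homOfLE (inf_le_left : V ⊓ U i ≤ V)).op y) : x = y :=
  X.sheaf.eq_of_locally_eq' (fun i => V ⊓ U i) V (fun _ => homOfLE inf_le_left)
    (by rw [← inf_iSup_eq]; exact le_inf le_rfl hV) x y h

theorem exists_glue {ι : Type*} (U : ι → X.Opens) (s : ∀ i, DualSection E (U i))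
    (hs : ∀ (i j : ι) (V : X.Opens) (hi : V ≤ U i) (hj : V ≤ U j),
      (s i).1 ⟨V, hi⟩ = (s j).1 ⟨V, hj⟩) {V : X.Opens} (hV : V ≤ iSup U) (m : Γ(E, V)) :
    ∃ x : Γ(X, V), ∀ i, X.presheaf.map (homOfLE (inf_le_left : V ⊓ U i ≤ V)).op x =
      (s i).1 ⟨V ⊓ U i, inf_le_right⟩ (E.presheaf.map (homOfLE inf_le_left).op m) := by
  obtain ⟨x, hx, -⟩ := X.sheaf.existsUnique_gluing' (fun i => V ⊓ U i) V
    (fun _ => homOfLE inf_le_left) (by rw [← inf_iSup_eq]; exact le_inf le_rfl hV)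
    (fun i => (s i).1 ⟨V ⊓ U i, inf_le_right⟩ (E.presheaf.map (homOfLE inf_le_left).op m)) (by
      intro i j
      let W : X.Opens := (V ⊓ U i) ⊓ (V ⊓ U j)
      have hi := (s i).2 ⟨V ⊓ U i, inf_le_right⟩ ⟨W, inf_le_left.trans inf_le_right⟩ inf_le_left
        (E.presheaf.map (homOfLE inf_le_left).op m)
      have hj := (s j).2 ⟨V ⊓ U j, inf_le_right⟩ ⟨W, inf_le_right.trans inf_le_right⟩ inf_le_right
        (E.presheaf.map (homOfLE inf_le_left).op m)
      refine hi.symm.trans (Eq.trans ?_ hj)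
      rw [hs i j W (inf_le_left.trans inf_le_right) (inf_le_right.trans inf_le_right)]
      rw [← ConcreteCategory.comp_apply, ← ConcreteCategory.comp_apply, ← Functor.map_comp,
        ← Functor.map_comp]
      rfl)
  exact ⟨x, hx⟩

theorem exists_glued_section {ι : Type*} (U : ι → X.Opens) (s : ∀ i, DualSection E (U i))
    (hs : ∀ (i j : ι) (V : X.Opens) (hi : V ≤ U i) (hj : V ≤ U j),
      (s i).1 ⟨V, hi⟩ = (s j).1 ⟨V, hj⟩) :
    ∃ t : DualSection E (iSup U), ∀ i, DualSection.restrict E (le_iSup U i) t = s i := by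
  choose g hg using fun (V : {V : X.Opens // V ≤ iSup U}) (m : Γ(E, V.1)) =>
    exists_glue E U s hs V.2 m
  refine ⟨⟨fun V =>
    { toFun := g V
      map_add' := fun m m' => eq_of_eq_on_cover U V.2 _ _ fun i => by
        simp only [map_add, hg]
      map_smul' := fun r m => eq_of_eq_on_cover U V.2 _ _ fun i => by
        simp only [map_mul, hg, smul_eq_mul, RingHom.id_apply, Scheme.Modules.map_smul,
          map_smul] }, ?_⟩, ?_⟩
  · intro V W h m
    refine eq_of_eq_on_cover U W.2 _ _ fun i => ?_
    refine (hg W _ i).trans ?_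
    have h1 := (s i).2 ⟨V.1 ⊓ U i, inf_le_right⟩ ⟨W.1 ⊓ U i, inf_le_right⟩
      (inf_le_inf_right _ h) (E.presheaf.map (homOfLE inf_le_left).op m)
    rw [← hg V m i] at h1
    rw [← ConcreteCategory.comp_apply, ← Functor.map_comp] at h1 ⊢
    refine h1.trans ?_
    change X.presheaf.map _ _ = X.presheaf.map _ (X.presheaf.map _ (g V m))
    rw [← CommRingCat.comp_apply, ← CommRingCat.comp_apply, ← Functor.map_comp,
      ← Functor.map_comp]
    rfl
  · intro i
    refine Subtype.ext <| funext fun V => LinearMap.ext fun m => ?_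
    refine eq_of_eq_on_cover U (V.2.trans (le_iSup U i)) _ _ fun j => ?_
    refine (hg ⟨V.1, V.2.trans (le_iSup U i)⟩ m j).trans ?_
    rw [hs j i (V.1 ⊓ U j) inf_le_right (inf_le_left.trans V.2)]
    exact (s i).2 V ⟨V.1 ⊓ U j, inf_le_left.trans V.2⟩ inf_le_left m

theorem dualPresheaf_isSheaf : (dualPresheaf E).IsSheaf := by
  rw [TopCat.Presheaf.isSheaf_iff_isSheafUniqueGluing]
  intro ι U s hs
  obtain ⟨t, ht⟩ := exists_glued_section E U s (fun i j V hi hj =>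
    congrArg (fun q : DualSection E (U i ⊓ U j) => q.1 ⟨V, le_inf hi hj⟩) (hs i j))
  refine ⟨t, ht, fun t' ht' => ?_⟩
  refine Subtype.ext <| funext fun V => LinearMap.ext fun m => ?_
  refine eq_of_eq_on_cover U V.2 _ _ fun i => ?_
  have h1 := Subtype.prop (show DualSection E (iSup U) from t') V
    ⟨V.1 ⊓ U i, inf_le_left.trans V.2⟩ inf_le_left m
  have h2 := t.2 V ⟨V.1 ⊓ U i, inf_le_left.trans V.2⟩ inf_le_left m
  refine h1.symm.trans (Eq.trans ?_ h2)
  have h3 : DualSection.restrict E (le_iSup U i) t' = DualSection.restrict E (le_iSup U i) t :=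
    (ht' i).trans (ht i).symm
  exact congrArg (fun q : DualSection E (U i) => q.1 ⟨V.1 ⊓ U i, inf_le_right⟩
    (E.presheaf.map (homOfLE inf_le_left).op m)) h3

theorem DualSection.restrict_smul {U V : X.Opens} (h : V ≤ U) (r : Γ(X, U))
    (s : DualSection E U) :
    restrict E h (r • s) = X.presheaf.map (homOfLE h).op r • restrict E h s := by
  refine Subtype.ext <| funext fun W => ?_
  rw [DualSection.smul_apply, ← CommRingCat.comp_apply, ← Functor.map_comp]
  rfl

/-- The dual sheaf `E^∨ = ℋom_{𝒪_X}(E, 𝒪_X)`. -/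
def dual : X.Modules where
  val := PresheafOfModules.ofPresheaf (R := X.ringCatSheaf.obj) (dualPresheaf E)
    fun _ _ f r s => DualSection.restrict_smul E f.unop.le r s
  isSheaf := dualPresheaf_isSheaf E

/-- The `𝒪_X(V)`-linear map `E(V) → 𝒪_X(V)` given by a section `s` of `E^∨` over `U ⊇ V`. -/
def pairing {U : X.Opens} (s : Γ(dual E, U)) {V : X.Opens} (h : V ≤ U) :
    Γ(E, V) →ₗ[Γ(X, V)] Γ(X, V) :=
  (show DualSection E U from s).1 ⟨V, h⟩

/-- Evaluation at a section `m` of `E` over `U`, as a section of `E^∨^∨` over `U`. -/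
def evaluation {U : X.Opens} (m : Γ(E, U)) : DualSection (dual E) U where
  val V :=
    { toFun := fun s => pairing E s le_rfl (E.presheaf.map (homOfLE V.2).op m)
      map_add' := fun _ _ => rfl
      map_smul' := fun r s => by
        change X.presheaf.map (homOfLE le_rfl).op r • pairing E s le_rfl _ = _
        have : (homOfLE (le_refl V.1)).op = 𝟙 (op V.1) := rfl
        rw [this, X.presheaf.map_id]
        rfl }
  property V W h s := by
    change pairing E s h _ = X.presheaf.map (homOfLE h).op (pairing E s le_rfl _)
    refine Eq.trans ?_ ((show DualSection E V.1 from s).2 ⟨V.1, le_rfl⟩ ⟨W.1, h⟩ h _)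
    change pairing E s h _ = pairing E s h _
    rw [← ConcreteCategory.comp_apply, ← Functor.map_comp]
    rfl

theorem evaluation_add {U : X.Opens} (m m' : Γ(E, U)) :
    evaluation E (m + m') = evaluation E m + evaluation E m' := by
  refine Subtype.ext <| funext fun V => LinearMap.ext fun s => ?_
  change pairing E s le_rfl _ = pairing E s le_rfl _ + pairing E s le_rfl _
  rw [map_add, map_add]

theorem evaluation_smul {U : X.Opens} (r : Γ(X, U)) (m : Γ(E, U)) :
    evaluation E (r • m) = r • evaluation E m := by
  refine Subtype.ext <| funext fun V => LinearMap.ext fun s => ?_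
  change pairing E s le_rfl _ = X.presheaf.map (homOfLE V.2).op r • pairing E s le_rfl _
  rw [Scheme.Modules.map_smul, map_smul]

theorem evaluation_restrict {U V : X.Opens} (h : V ≤ U) (m : Γ(E, U)) :
    evaluation E (E.presheaf.map (homOfLE h).op m) =
      DualSection.restrict (dual E) h (evaluation E m) := by
  refine Subtype.ext <| funext fun W => LinearMap.ext fun s => ?_
  change pairing E s le_rfl _ = pairing E s le_rfl _
  rw [← ConcreteCategory.comp_apply, ← Functor.map_comp]
  rfl

/-- The natural morphism `E ⟶ E^∨^∨`. -/
def toDoubleDual : E ⟶ dual (dual E) :=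
  SheafOfModules.Hom.mk (PresheafOfModules.homMk
    { app U := AddCommGrpCat.ofHom
        (AddMonoidHom.mk' (fun m : Γ(E, U.unop) => evaluation E m) (evaluation_add E))
      naturality U V f := by
        ext m
        exact evaluation_restrict E f.unop.le m }
    fun U r m => evaluation_smul E (U := U.unop) r m)

/-- `E` is reflexive if the natural morphism into its double dual is an isomorphism. -/
def IsReflexive : Prop := IsIso (toDoubleDual E)

/-- Coherent sheaves on a (locally) Noetherian scheme: quasi-coherent sheaves whose sections over
every affine open set form a finitely generated module. -/
def IsCoherent : Prop :=
  E.IsQuasicoherent ∧ ∀ U : X.Opens, IsAffineOpen U → Module.Finite Γ(X, U) Γ(E, U)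

end Dual

section Decoration

variable {X : Scheme.{u}} [IsIntegral X]

/-- The generic stalk `E_η`. -/
abbrev genericStalk (E : X.Modules) : Type u :=
  (TopCat.Presheaf.stalk (C := Ab.{u}) (X := X.toTopCat) E.val.presheaf (genericPoint X) : Ab.{u})

/-- The generic stalk is a vector space over the function field, with
`(germ r) • (germ m) = germ (r • m)`; see `germ_smul` below. -/
instance (E : X.Modules) : Module X.functionField (genericStalk E) :=
  PresheafOfModules.instModuleCarrierStalkCommRingCatCarrierAbPresheafOpensCarrier
    (R := X.presheaf) E.val (genericPoint X)

/-- The map `E(U) → E_η` from sections over a (nonempty) open set to the generic stalk. -/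
def germ (E : X.Modules) {U : X.Opens} (hU : genericPoint X ∈ U) : Γ(E, U) →+ genericStalk E :=
  (TopCat.Presheaf.germ (C := Ab.{u}) (X := X.toTopCat) E.val.presheaf U (genericPoint X) hU).hom

theorem germ_smul (E : X.Modules) {U : X.Opens} (hU : genericPoint X ∈ U) (r : Γ(X, U))
    (m : Γ(E, U)) :
    germ E hU (r • m) = X.presheaf.germ U (genericPoint X) hU r • germ E hU m :=
  PresheafOfModules.germ_smul (R := X.presheaf) E.val (genericPoint X) U hU r m

/-- The sections over `U` of the subsheaf `(1/e) ⋅ ((K ⋅ e) ∩ E)` of `K`: the rational functions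
`f` for which `f ⋅ e` lies in (the image in `E_η` of) `E(U)`. -/
def lineSections (E : X.Modules) (e : genericStalk E) {U : X.Opens} (hU : genericPoint X ∈ U) :
    Set X.functionField :=
  {f | f • e ∈ Set.range (germ E hU)}

variable [IsNoetherian X]

/-- `D` satisfies `𝒪_X(D) ⋅ e = (K ⋅ e) ∩ E`. -/
def IsDivisorOf (E : X.Modules) (e : genericStalk E) (D : WeilDivisor X) : Prop :=
  ∀ (U : X.Opens) (hU : genericPoint X ∈ U), sectionsOfDivisor D U = lineSections E e hU

/-- The divisor `D(e)` with `𝒪_X(D(e)) ⋅ e = (K ⋅ e) ∩ E`, for `e ≠ 0`. (It is unique if it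
exists, and it exists if `E` is reflexive and `X` is a normal variety.) -/
def divisorOf (E : X.Modules) (e : genericStalk E) : WeilDivisor X :=
  Classical.epsilon (IsDivisorOf E e)

/-- The Weil decoration `W_E : E_η → Div(X) ∪ {∞}`, with `W_E(e) = D(e)` for `e ≠ 0` and
`W_E(0) = ∞`. -/
def weilDecoration (E : X.Modules) (e : genericStalk E) : WithTop (WeilDivisor X) :=
  open Classical in
  if e = 0 then ⊤ else ((divisorOf E e : WeilDivisor X) : WithTop (WeilDivisor X))

/-- The canonical isomorphism `(E^∨)_η ≅ (E_η)^∨` is the one which sends the germ of a section `s`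
of `E^∨` to the linear form induced by `s` on germs of sections of `E`. Since every element of a
stalk is a germ, there is at most one such `c`. -/
def IsCanonicalDualIso (E : X.Modules)
    (c : genericStalk (dual E) ≃ₗ[X.functionField] Module.Dual X.functionField (genericStalk E)) :
    Prop :=
  ∀ (U V : X.Opens) (hU : genericPoint X ∈ U) (hV : genericPoint X ∈ V) (h : V ≤ U)
    (s : Γ(dual E, U)) (m : Γ(E, V)),
    c (germ (dual E) hU s) (germ E hV m) =
      X.presheaf.germ V (genericPoint X) hV (pairing E s h m)

/-- The differences `div(φ(v)) - W_E(v)` in `Div(X) ∪ {∞}`, for `0 ≠ v ∈ E_η`. -/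
def dualDifferences (E : X.Modules) (φ : Module.Dual X.functionField (genericStalk E)) :
    Set (WithTop (WeilDivisor X)) :=
  {D | ∃ v : genericStalk E, v ≠ 0 ∧
    D = divTop (φ v) + ((-divisorOf E v : WeilDivisor X) : WithTop (WeilDivisor X))}

end Decoration

end

end WeilDeco

open WeilDeco

/-!
At a prime divisor `P` of a normal Noetherian scheme the local ring is a discrete valuation ring,
and for `0 ≠ e` the rational functions `f` with `f • e ∈ E_P` form a fractional ideal of it; its
exponent is the coefficient of `W_E(e)` at `P`. Almost all of these coefficients vanish, since a
linear form with value `1` at `e` is regular on `E_x` for all `x` near the generic point. They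
determine a divisor with `𝒪_X(D) ⋅ e = (K ⋅ e) ∩ E` because rational functions, and hence sections
of a dual sheaf, extend over codimension two. A reflexive sheaf is a dual sheaf.

As `E` is coherent, a linear form `φ` belongs to `(E^∨)_P` exactly if `φ(E_P) ⊆ 𝒪_{X,P}`, that is,
if `W_E(v)_P ≤ ord_P(φ(v))` for all `v`. Applied to `f • φ` with `ord_P f = -n`, this says that
`n ≤ W_{E^∨}(φ)_P` if and only if `n` is a lower bound of the integers `ord_P(φ(v)) - W_E(v)_P`.
-/

namespace WeilDeco

open TopologicalSpace Opposite

noncomputable section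

section Algebra

variable {A K : Type*} [CommRing A]

theorem exists_isPrime_colon_smul [IsNoetherianRing A] {M : Type*} [AddCommGroup M] [Module A M]
    {N : Submodule A M} {x : M} (hx : x ∉ N) : ∃ c : A, (N.colon {c • x}).IsPrime := by
  let L : Submodule A (M ⧸ N) := Submodule.span A {N.mkQ x}
  let x' : L := ⟨N.mkQ x, Submodule.mem_span_singleton_self _⟩
  have hx' : x' ≠ 0 := fun h => hx ((Submodule.Quotient.mk_eq_zero N).mp (congrArg Subtype.val h))
  obtain ⟨p, hp, -⟩ := exists_le_isAssociatedPrime_of_isNoetherianRing A x' hx'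
  obtain ⟨hp, ⟨_, hy⟩, rfl⟩ := isAssociatedPrime_iff.mp hp
  obtain ⟨c, rfl⟩ := Submodule.mem_span_singleton.mp hy
  refine ⟨c, ?_⟩
  convert hp using 1
  ext r
  rw [Submodule.mem_colon_singleton, Submodule.mem_colon_singleton, Submodule.mem_bot,
    ← Submodule.Quotient.mk_eq_zero, Subtype.ext_iff]
  rfl

section Localization

variable {B : Type*} [CommRing B] [CommRing K] [Algebra A B] [Algebra A K] [Algebra B K]
  [IsScalarTower A B K] {g : K} {p : Ideal A} [p.IsPrime] [IsLocalization.AtPrime B p]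

theorem notMem_one_of_eq_colon (hp : p = (1 : Submodule A K).colon {g}) :
    g ∉ (1 : Submodule B K) := by
  intro hg
  obtain ⟨z, rfl⟩ := Submodule.mem_one.mp hg
  obtain ⟨⟨a, s⟩, hs⟩ := IsLocalization.surj p.primeCompl z
  refine s.2 (hp.ge (Submodule.mem_colon_singleton.mpr (Submodule.mem_one.mpr ⟨a, ?_⟩)))
  rw [IsScalarTower.algebraMap_apply A B K, ← hs, map_mul, mul_comm, Algebra.smul_def,
    ← IsScalarTower.algebraMap_apply]

theorem smul_mem_one_of_eq_colon [IsLocalRing B] (hp : p = (1 : Submodule A K).colon {g}) {r : B}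
    (hr : r ∈ IsLocalRing.maximalIdeal B) : r • g ∈ (1 : Submodule B K) := by
  obtain ⟨a, s, rfl⟩ := IsLocalization.exists_mk'_eq p.primeCompl r
  have ha : a ∈ p := (IsLocalization.AtPrime.mk'_mem_maximal_iff B p a s).mp hr
  obtain ⟨b, hb⟩ := Submodule.mem_one.mp (Submodule.mem_colon_singleton.mp (hp ▸ ha))
  rw [IsLocalization.mk'_eq_mul_mk'_one, mul_comm, mul_smul, algebraMap_smul, ← hb,
    IsScalarTower.algebraMap_apply A B K]
  exact Submodule.smul_mem _ _ (Submodule.mem_one.mpr ⟨_, rfl⟩)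

end Localization

theorem mem_one_of_smul_ideal [Field K] [IsNoetherianRing A] [IsIntegrallyClosed A] [Algebra A K]
    [IsFractionRing A K] {I : Ideal A} (hI : I ≠ ⊥) {g : K}
    (h : ∀ r ∈ I, ∃ s ∈ I, algebraMap A K s = r • g) : g ∈ (1 : Submodule A K) := by
  refine Submodule.mem_one.mpr (IsIntegrallyClosed.isIntegral_iff.mp ?_)
  refine isIntegral_of_smul_mem_submodule (Submodule.map (Algebra.linearMap A K) I) ?_
    ((IsNoetherian.noetherian I).map _) g ?_
  · rwa [← Submodule.map_bot (Algebra.linearMap A K),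
      (Submodule.map_injective_of_injective (IsFractionRing.injective A K)).ne_iff]
  · rintro _ ⟨r, hr, rfl⟩
    obtain ⟨s, hs, hsr⟩ := h r hr
    exact ⟨s, hs, by rw [Algebra.linearMap_apply, hsr, Algebra.linearMap_apply, smul_eq_mul,
      mul_comm, Algebra.smul_def]⟩

theorem eq_span_singleton_of_smul_eq_one [Field K] [Algebra A K] [FaithfulSMul A K] {I : Ideal A}
    {g : K} (h : ∀ r ∈ I, r • g ∈ (1 : Submodule A K)) {t : A} (ht : t ∈ I) (htg : t • g = 1) :
    I = Ideal.span {t} := by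
  refine le_antisymm (fun x hx => ?_) ((Ideal.span_singleton_le_iff_mem I).mpr ht)
  obtain ⟨y, hy⟩ := Submodule.mem_one.mp (h x hx)
  refine Ideal.mem_span_singleton'.mpr ⟨y, FaithfulSMul.algebraMap_injective A K ?_⟩
  rw [Algebra.smul_def] at hy htg
  rw [map_mul, hy]
  linear_combination algebraMap A K x * htg

theorem isDiscreteValuationRing_of_maximalIdeal_smul_le [IsDomain A] [IsNoetherianRing A]
    [IsLocalRing A] [IsIntegrallyClosed A] [Field K] [Algebra A K] [IsFractionRing A K] {g : K}
    (hg : g ∉ (1 : Submodule A K))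
    (h : ∀ r ∈ IsLocalRing.maximalIdeal A, r • g ∈ (1 : Submodule A K)) :
    IsDiscreteValuationRing A := by
  have hA : ¬ IsField A := fun hA => hg (Submodule.mem_one.mpr
    ((IsFractionRing.surjective_iff_isField (R := A) (K := K)).mpr hA g))
  refine ((IsDiscreteValuationRing.TFAE A hA).out 0 4).mpr ?_
  obtain ⟨r, hr, b, hb, hbr⟩ : ∃ r ∈ IsLocalRing.maximalIdeal A, ∃ b : A, IsUnit b ∧
      algebraMap A K b = r • g := by
    by_contra! hnu
    refine hg (mem_one_of_smul_ideal (mt IsLocalRing.isField_iff_maximalIdeal_eq.mpr hA)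
      fun r hr => ?_)
    obtain ⟨b, hb⟩ := Submodule.mem_one.mp (h r hr)
    exact ⟨b, (IsLocalRing.mem_maximalIdeal b).mpr fun hu => hnu r hr b hu hb, hb⟩
  obtain ⟨c, hc⟩ := hb.exists_left_inv
  have hcr : (c * r) • g = 1 := by
    rw [mul_smul, ← hbr, Algebra.smul_def, ← map_mul, hc, map_one]
  exact ⟨_, eq_span_singleton_of_smul_eq_one h (Ideal.mul_mem_left _ c hr) hcr⟩

theorem one_le_ordFrac_iff [IsDomain A] [IsDiscreteValuationRing A] [Field K] [Algebra A K]
    [IsFractionRing A K] [Ring.KrullDimLE 1 A] {f : K} (hf : f ≠ 0) :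
    1 ≤ Ring.ordFrac A f ↔ f ∈ (1 : Submodule A K) := by
  rw [Submodule.mem_one]
  constructor
  · intro h
    refine IsDiscreteValuationRing.exists_lift_of_le_one ?_
    rwa [Ring.ordFrac_eq_valuation_inv, one_le_inv₀ (by simpa [WithZero.pos_iff_ne_zero])] at h
  · rintro ⟨x, rfl⟩
    exact Ring.ordFrac_ge_one_of_ne_zero (by rintro rfl; simp at hf)

end Algebra

section RegularFunctions

variable {X : Scheme.{u}} [IsIntegral X]

theorem genericPoint_mem {U : X.Opens} {x : X} (hx : x ∈ U) : genericPoint X ∈ U :=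
  (genericPoint_specializes x).mem_open U.isOpen hx

/-- The local ring of `X` at `x`, as a subring of the function field. -/
def regularAt (x : X) : Subring X.functionField :=
  (algebraMap (X.presheaf.stalk x) X.functionField).range

theorem mem_regularAt_iff_mem_one {x : X} {f : X.functionField} :
    f ∈ regularAt x ↔ f ∈ (1 : Submodule (X.presheaf.stalk x) X.functionField) :=
  Submodule.mem_one.symm

theorem algebraMap_germ {U : X.Opens} {x : X} (hx : x ∈ U) (r : Γ(X, U)) :
    algebraMap (X.presheaf.stalk x) X.functionField (X.presheaf.germ U x hx r) =
      X.presheaf.germ U (genericPoint X) (genericPoint_mem hx) r :=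
  have : Nonempty U := ⟨⟨x, hx⟩⟩
  Scheme.algebraMap_germ_eq_germToFunctionField X hx r

theorem germ_mem_regularAt {U : X.Opens} (hU : genericPoint X ∈ U) {x : X} (hx : x ∈ U)
    (r : Γ(X, U)) : X.presheaf.germ U (genericPoint X) hU r ∈ regularAt x :=
  ⟨X.presheaf.germ U x hx r, algebraMap_germ hx r⟩

theorem mem_regularAt_iff {x : X} {f : X.functionField} :
    f ∈ regularAt x ↔ ∃ (U : X.Opens) (hx : x ∈ U) (r : Γ(X, U)),
      X.presheaf.germ U (genericPoint X) (genericPoint_mem hx) r = f := by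
  constructor
  · rintro ⟨a, rfl⟩
    obtain ⟨U, hx, r, rfl⟩ := X.presheaf.exists_germ_eq a
    exact ⟨U, hx, r, (algebraMap_germ hx r).symm⟩
  · rintro ⟨U, hx, r, rfl⟩
    exact germ_mem_regularAt _ hx r

theorem mem_regularAt_genericPoint (f : X.functionField) : f ∈ regularAt (genericPoint X) := by
  obtain ⟨U, hU, r, rfl⟩ := X.presheaf.exists_germ_eq f
  exact germ_mem_regularAt hU hU r

theorem isOpen_setOf_mem_regularAt (f : X.functionField) : IsOpen {x : X | f ∈ regularAt x} := by
  refine isOpen_iff_forall_mem_open.mpr fun x hx => ?_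
  obtain ⟨U, hxU, r, rfl⟩ := mem_regularAt_iff.mp hx
  exact ⟨U, fun y hy => germ_mem_regularAt _ hy r, U.isOpen, hxU⟩

theorem ext_germ_genericPoint {U : X.Opens} {r t : Γ(X, U)}
    (h : ∀ hU : genericPoint X ∈ U, X.presheaf.germ U (genericPoint X) hU r =
      X.presheaf.germ U (genericPoint X) hU t) : r = t := by
  by_cases hU : genericPoint X ∈ U
  · exact germ_injective_of_isIntegral X (genericPoint X) hU (h hU)
  · obtain rfl : U = ⊥ := eq_bot_iff.mpr fun x hx => hU (genericPoint_mem hx)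
    exact Subsingleton.elim r t

theorem exists_germ_eq_of_forall_mem_regularAt {U : X.Opens} (hU : genericPoint X ∈ U)
    {f : X.functionField} (h : ∀ x ∈ U, f ∈ regularAt x) :
    ∃ r : Γ(X, U), X.presheaf.germ U (genericPoint X) hU r = f := by
  choose V hxV r hr using fun x : U => mem_regularAt_iff.mp (h x.1 x.2)
  let W : U → X.Opens := fun x => V x ⊓ U
  have hxW (x : U) : x.1 ∈ W x := ⟨hxV x, x.2⟩
  let r' (x : U) : Γ(X, W x) := X.presheaf.map (homOfLE inf_le_left).op (r x)
  have hr' (x : U) :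
      X.presheaf.germ (W x) (genericPoint X) (genericPoint_mem (hxW x)) (r' x) = f :=
    (X.presheaf.germ_res_apply _ _ _ _).trans (hr x)
  obtain ⟨t, ht, -⟩ := X.sheaf.existsUnique_gluing' W U (fun _ => homOfLE inf_le_right)
    (fun x hx => Opens.mem_iSup.mpr ⟨⟨x, hx⟩, hxW ⟨x, hx⟩⟩) r' fun x y =>
      ext_germ_genericPoint fun _ =>
        (X.presheaf.germ_res_apply _ _ _ _).trans <| (hr' x).trans <|
          (hr' y).symm.trans (X.presheaf.germ_res_apply _ _ _ _).symm
  refine ⟨t, Eq.trans ?_ (hr' ⟨_, hU⟩)⟩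
  rw [← ht ⟨_, hU⟩]
  exact (X.presheaf.germ_res_apply _ _ _ _).symm

end RegularFunctions

section Hartogs

variable {X : Scheme.{u}} [IsIntegral X]

theorem coheight_eq_one_of_isDiscreteValuationRing (x : X)
    [IsDiscreteValuationRing (X.presheaf.stalk x)] : Order.coheight x = 1 := by
  have h := IsDiscreteValuationRing.ringKrullDim_eq_one (X.presheaf.stalk x)
  rw [ringKrullDim_stalk_eq_coheight] at h
  exact_mod_cast h

variable [IsLocallyNoetherian X]

instance isDiscreteValuationRing_stalk (P : PrimeDivisor X)
    [IsIntegrallyClosed (X.presheaf.stalk P.1)] :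
    IsDiscreteValuationRing (X.presheaf.stalk P.1) := by
  have hdim : ringKrullDim (X.presheaf.stalk P.1) = 1 := by
    rw [ringKrullDim_stalk_eq_coheight, P.2]; rfl
  have hle : Ring.KrullDimLE 1 (X.presheaf.stalk P.1) := krullDimLE_of_coheight_le P.2.le
  have : Ring.DimensionLEOne (X.presheaf.stalk P.1) :=
    ⟨fun {p} hp0 hp => Ring.krullDimLE_one_iff_of_noZeroDivisors.mp hle p hp0 hp⟩
  have : IsDedekindDomain (X.presheaf.stalk P.1) := { }
  exact ((IsDiscreteValuationRing.TFAE _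
    (ringKrullDim_eq_one_iff_of_isLocalRing_isDomain.mp hdim).1).out 0 2).mpr this

theorem mem_regularAt_iff_ord_nonneg (P : PrimeDivisor X)
    [IsDiscreteValuationRing (X.presheaf.stalk P.1)] {f : X.functionField} (hf : f ≠ 0) :
    f ∈ regularAt P.1 ↔ 0 ≤ Scheme.ord f P.1 := by
  have : Ring.KrullDimLE 1 (X.presheaf.stalk P.1) := krullDimLE_of_coheight_le P.2.le
  rw [Scheme.le_ord_iff P.2 hf, mem_regularAt_iff_mem_one]
  exact (one_le_ordFrac_iff hf).symm

theorem exists_ord_eq (P : PrimeDivisor X) [IsDiscreteValuationRing (X.presheaf.stalk P.1)]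
    (n : ℤ) : ∃ f : X.functionField, f ≠ 0 ∧ Scheme.ord f P.1 = n := by
  have : Ring.KrullDimLE 1 (X.presheaf.stalk P.1) := krullDimLE_of_coheight_le P.2.le
  obtain ⟨ϖ, hϖ⟩ := IsDiscreteValuationRing.exists_irreducible (X.presheaf.stalk P.1)
  have hne : algebraMap (X.presheaf.stalk P.1) X.functionField ϖ ^ n ≠ 0 :=
    zpow_ne_zero _ ((map_ne_zero_iff _ (IsFractionRing.injective _ _)).mpr hϖ.ne_zero)
  refine ⟨_, hne, (Scheme.ord_eq_iff P.2 hne).mpr ?_⟩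
  have hord : Scheme.ordHom P.1 P.2 (algebraMap (X.presheaf.stalk P.1) X.functionField ϖ) =
    WithZero.exp 1 := Ring.ordFrac_irreducible hϖ
  rw [map_zpow₀, hord, ← WithZero.exp_zsmul, smul_eq_mul, mul_one]
  rfl

theorem exists_isDiscreteValuationRing_stalk_notMem_regularAt
    [∀ x : X, IsIntegrallyClosed (X.presheaf.stalk x)] {U : X.Opens} (hU : IsAffineOpen U)
    (hη : genericPoint X ∈ U) {f : X.functionField}
    (hf : f ∉ Set.range (X.presheaf.germ U (genericPoint X) hη)) :
    ∃ x ∈ U, IsDiscreteValuationRing (X.presheaf.stalk x) ∧ f ∉ regularAt x := by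
  have : Nonempty U := ⟨⟨_, hη⟩⟩
  have : IsNoetherianRing Γ(X, U) := IsLocallyNoetherian.component_noetherian ⟨U, hU⟩
  obtain ⟨c, hp⟩ := exists_isPrime_colon_smul (N := (1 : Submodule Γ(X, U) X.functionField))
    (mt Submodule.mem_one.mp hf)
  let p : Ideal Γ(X, U) := (1 : Submodule Γ(X, U) X.functionField).colon {c • f}
  have : p.IsPrime := hp
  let x : X := hU.fromSpec ⟨p, hp⟩
  have hxU : x ∈ U := by
    rw [← SetLike.mem_coe, ← hU.range_fromSpec]
    exact Set.mem_range_self _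
  let := X.presheaf.algebra_section_stalk ⟨x, hxU⟩
  have : IsLocalization.AtPrime (X.presheaf.stalk x) p := hU.isLocalization_stalk' ⟨p, hp⟩ hxU
  have : IsScalarTower Γ(X, U) (X.presheaf.stalk x) X.functionField :=
    functionField_isScalarTower X U ⟨x, hxU⟩
  have hcf := notMem_one_of_eq_colon (p := p) (B := X.presheaf.stalk x) rfl
  refine ⟨x, hxU, isDiscreteValuationRing_of_maximalIdeal_smul_le hcf fun r hr =>
    smul_mem_one_of_eq_colon (p := p) rfl hr, fun hx => hcf ?_⟩
  rw [← mem_regularAt_iff_mem_one, Algebra.smul_def]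
  exact mul_mem (germ_mem_regularAt hη hxU c) hx

theorem exists_germ_eq_of_forall_primeDivisor [∀ x : X, IsIntegrallyClosed (X.presheaf.stalk x)]
    {U : X.Opens} (hη : genericPoint X ∈ U) {f : X.functionField}
    (h : ∀ P : PrimeDivisor X, P.1 ∈ U → f ∈ regularAt P.1) :
    ∃ r : Γ(X, U), X.presheaf.germ U (genericPoint X) hη r = f := by
  refine exists_germ_eq_of_forall_mem_regularAt hη fun x hx => ?_
  obtain ⟨_, ⟨V, hV, rfl⟩, hxV, hVU⟩ := X.isBasis_affineOpens.exists_subset_of_mem_open hx U.isOpen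
  by_contra hf
  obtain ⟨y, hyV, hy, hfy⟩ :=
    exists_isDiscreteValuationRing_stalk_notMem_regularAt hV (genericPoint_mem hxV) (f := f)
      (by rintro ⟨r, rfl⟩; exact hf (germ_mem_regularAt _ hxV r))
  exact hfy (h ⟨y, coheight_eq_one_of_isDiscreteValuationRing y⟩ (hVU hyV))

end Hartogs

section GenericStalk

variable {X : Scheme.{u}} {E : X.Modules}

theorem pairing_res {U V W : X.Opens} (s : Γ(dual E, U)) (hV : V ≤ U) (hWV : W ≤ V) (m : Γ(E, V)) :
    pairing E s (hWV.trans hV) (E.presheaf.map (homOfLE hWV).op m) =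
      X.presheaf.map (homOfLE hWV).op (pairing E s hV m) :=
  (show DualSection E U from s).2 ⟨V, hV⟩ ⟨W, hWV.trans hV⟩ hWV m

variable [IsIntegral X] {M : Type*} [AddCommGroup M] [Module X.functionField M]

theorem structureSheaf_germ_res {U V : X.Opens} (h : V ≤ U) (hV : genericPoint X ∈ V)
    (r : Γ(X, U)) :
    X.presheaf.germ V (genericPoint X) hV (X.presheaf.map (homOfLE h).op r) =
      X.presheaf.germ U (genericPoint X) (h hV) r :=
  X.presheaf.germ_res_apply (homOfLE h) (genericPoint X) hV r

theorem germ_res {U V : X.Opens} (h : V ≤ U) (hV : genericPoint X ∈ V) (m : Γ(E, U)) :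
    germ E hV (E.presheaf.map (homOfLE h).op m) = germ E (h hV) m :=
  TopCat.Presheaf.germ_res_apply (C := Ab.{u}) (X := X.toTopCat) E.val.presheaf (homOfLE h)
    (genericPoint X) hV m

theorem exists_germ_eq {U : X.Opens} (hU : genericPoint X ∈ U) (e : genericStalk E) :
    ∃ (V : X.Opens) (_ : V ≤ U) (hV : genericPoint X ∈ V) (m : Γ(E, V)), germ E hV m = e := by
  obtain ⟨V, hV, m, rfl⟩ := TopCat.Presheaf.exists_germ_eq (C := Ab.{u}) (X := X.toTopCat)
    E.val.presheaf e
  exact ⟨U ⊓ V, inf_le_left, ⟨hU, hV⟩, _, germ_res inf_le_right ⟨hU, hV⟩ m⟩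

theorem exists_germ_eq₂ {U : X.Opens} (hU : genericPoint X ∈ U) (e e' : genericStalk E) :
    ∃ (V : X.Opens) (_ : V ≤ U) (hV : genericPoint X ∈ V) (m m' : Γ(E, V)),
      germ E hV m = e ∧ germ E hV m' = e' := by
  obtain ⟨V, hVU, hV, m, rfl⟩ := exists_germ_eq hU e
  obtain ⟨W, hWV, hW, m', rfl⟩ := exists_germ_eq hV e'
  exact ⟨W, hWV.trans hVU, hW, _, m', germ_res hWV hW m, rfl⟩

theorem exists_germ_eq_of_functionField {U : X.Opens} (hU : genericPoint X ∈ U)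
    (f : X.functionField) (e : genericStalk E) :
    ∃ (V : X.Opens) (_ : V ≤ U) (hV : genericPoint X ∈ V) (r : Γ(X, V)) (m : Γ(E, V)),
      X.presheaf.germ V (genericPoint X) hV r = f ∧ germ E hV m = e := by
  obtain ⟨W, hW, r, rfl⟩ := X.presheaf.exists_germ_eq f
  obtain ⟨V, hV, hηV, m, rfl⟩ := exists_germ_eq (U := U ⊓ W) ⟨hU, hW⟩ e
  exact ⟨V, hV.trans inf_le_left, hηV, _, m,
    structureSheaf_germ_res (hV.trans inf_le_right) hηV r, rfl⟩

theorem exists_res_eq_of_germ_eq {U V : X.Opens} {hU : genericPoint X ∈ U}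
    {hV : genericPoint X ∈ V} {m : Γ(E, U)} {n : Γ(E, V)} (h : germ E hU m = germ E hV n) :
    ∃ (W : X.Opens) (_ : genericPoint X ∈ W) (hWU : W ≤ U) (hWV : W ≤ V),
      E.presheaf.map (homOfLE hWU).op m = E.presheaf.map (homOfLE hWV).op n := by
  obtain ⟨W, hW, iU, iV, h'⟩ := TopCat.Presheaf.germ_eq (C := Ab.{u}) (X := X.toTopCat)
    E.val.presheaf (genericPoint X) hU hV m n h
  exact ⟨W, hW, iU.le, iV.le, h'⟩

theorem linearMap_ext_germ {U : X.Opens} (hU : genericPoint X ∈ U)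
    {φ ψ : genericStalk E →ₗ[X.functionField] M}
    (h : ∀ V ≤ U, ∀ (hV : genericPoint X ∈ V) (m : Γ(E, V)), φ (germ E hV m) = ψ (germ E hV m)) :
    φ = ψ := by
  refine LinearMap.ext fun e => ?_
  obtain ⟨V, hVU, hV, m, rfl⟩ := exists_germ_eq hU e
  exact h V hVU hV m

theorem exists_linearMap_germ_eq {U : X.Opens} (hU : genericPoint X ∈ U)
    (f : ∀ V ≤ U, genericPoint X ∈ V → Γ(E, V) →+ M)
    (hres : ∀ (V W : X.Opens) (hV : V ≤ U) (hWV : W ≤ V) (hW : genericPoint X ∈ W) (m : Γ(E, V)),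
      f W (hWV.trans hV) hW (E.presheaf.map (homOfLE hWV).op m) = f V hV (hWV hW) m)
    (hsmul : ∀ (V : X.Opens) (hV : V ≤ U) (hη : genericPoint X ∈ V) (r : Γ(X, V)) (m : Γ(E, V)),
      f V hV hη (r • m) = X.presheaf.germ V (genericPoint X) hη r • f V hV hη m) :
    ∃ φ : genericStalk E →ₗ[X.functionField] M,
      ∀ (V : X.Opens) (hV : V ≤ U) (hη : genericPoint X ∈ V) (m : Γ(E, V)),
        φ (germ E hη m) = f V hV hη m := by
  choose V hVU hV m hm using fun e : genericStalk E => exists_germ_eq hU e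
  let φ (e : genericStalk E) : M := f (V e) (hVU e) (hV e) (m e)
  have hφ (W : X.Opens) (hWU : W ≤ U) (hW : genericPoint X ∈ W) (n : Γ(E, W)) :
      φ (germ E hW n) = f W hWU hW n := by
    obtain ⟨W', hW', h₁, h₂, h⟩ := exists_res_eq_of_germ_eq (hm (germ E hW n))
    rw [← hres W W' hWU h₂ hW', ← h, hres]
  refine ⟨{ toFun := φ, map_add' := fun e e' => ?_, map_smul' := fun a e => ?_ }, hφ⟩
  · obtain ⟨W, hWU, hW, n, n', rfl, rfl⟩ := exists_germ_eq₂ hU e e'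
    rw [← map_add, hφ W hWU, hφ W hWU, hφ W hWU, map_add]
  · obtain ⟨W, hWU, hW, r, n, rfl, rfl⟩ := exists_germ_eq_of_functionField hU a e
    rw [← germ_smul, hφ W hWU, hφ W hWU, hsmul, RingHom.id_apply]

end GenericStalk

section CanonicalDualMap

variable {X : Scheme.{u}} [IsIntegral X] (E : X.Modules)

theorem exists_inducedForm {U : X.Opens} (hU : genericPoint X ∈ U) (s : Γ(dual E, U)) :
    ∃ φ : Module.Dual X.functionField (genericStalk E),
      ∀ (V : X.Opens) (hVU : V ≤ U) (hV : genericPoint X ∈ V) (m : Γ(E, V)),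
        φ (germ E hV m) = X.presheaf.germ V (genericPoint X) hV (pairing E s hVU m) := by
  refine exists_linearMap_germ_eq hU (fun V hVU hV =>
    ((X.presheaf.germ V (genericPoint X) hV).hom : Γ(X, V) →+ X.functionField).comp
      (pairing E s hVU : Γ(E, V) →+ Γ(X, V))) (fun V W hV hWV hW m => ?_) fun V hV hη r m => ?_
  · change X.presheaf.germ W _ hW (pairing E s (hWV.trans hV) _) = _
    rw [pairing_res, structureSheaf_germ_res]
    rfl
  · change X.presheaf.germ V _ hη (pairing E s hV (r • m)) = _
    rw [map_smul, smul_eq_mul, map_mul]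
    rfl

/-- The linear form on the generic stalk of `E` induced by a section of the dual sheaf. -/
def inducedForm {U : X.Opens} (hU : genericPoint X ∈ U) (s : Γ(dual E, U)) :
    Module.Dual X.functionField (genericStalk E) :=
  (exists_inducedForm E hU s).choose

variable {E}

theorem inducedForm_germ {U V : X.Opens} {hU : genericPoint X ∈ U} (s : Γ(dual E, U))
    (hVU : V ≤ U) (hV : genericPoint X ∈ V) (m : Γ(E, V)) :
    inducedForm E hU s (germ E hV m) =
      X.presheaf.germ V (genericPoint X) hV (pairing E s hVU m) :=
  (exists_inducedForm E hU s).choose_spec V hVU hV m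

theorem inducedForm_add {U : X.Opens} (hU : genericPoint X ∈ U) (s t : Γ(dual E, U)) :
    inducedForm E hU (s + t) = inducedForm E hU s + inducedForm E hU t :=
  linearMap_ext_germ hU fun V hVU hV m => by
    rw [LinearMap.add_apply, inducedForm_germ _ hVU, inducedForm_germ _ hVU,
      inducedForm_germ _ hVU, ← map_add]
    rfl

theorem inducedForm_smul {U : X.Opens} (hU : genericPoint X ∈ U) (r : Γ(X, U))
    (s : Γ(dual E, U)) :
    inducedForm E hU (r • s) = X.presheaf.germ U (genericPoint X) hU r • inducedForm E hU s :=
  linearMap_ext_germ hU fun V hVU hV m => by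
    rw [LinearMap.smul_apply, inducedForm_germ _ hVU, inducedForm_germ _ hVU, smul_eq_mul,
      ← structureSheaf_germ_res hVU hV, ← map_mul]
    rfl

theorem inducedForm_res {U V : X.Opens} (h : V ≤ U) (hV : genericPoint X ∈ V) (s : Γ(dual E, U)) :
    inducedForm E hV ((dual E).presheaf.map (homOfLE h).op s) = inducedForm E (h hV) s :=
  linearMap_ext_germ hV fun W hWV hW m => by
    rw [inducedForm_germ _ hWV, inducedForm_germ _ (hWV.trans h)]
    rfl

theorem inducedForm_injective {U : X.Opens} (hU : genericPoint X ∈ U) :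
    Function.Injective (inducedForm E hU) := by
  intro s t h
  change (show DualSection E U from s) = (show DualSection E U from t)
  refine Subtype.ext <| funext fun V => LinearMap.ext fun m => ext_germ_genericPoint fun hV => ?_
  exact (inducedForm_germ s V.2 hV m).symm.trans <|
    (LinearMap.congr_fun h _).trans (inducedForm_germ t V.2 hV m)

theorem exists_linearMap_germ_eq_apply {V : X.Opens}
    {φ : Module.Dual X.functionField (genericStalk E)}
    (h : ∀ (hV : genericPoint X ∈ V) (m : Γ(E, V)),
      ∃ r : Γ(X, V), X.presheaf.germ V (genericPoint X) hV r = φ (germ E hV m)) :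
    ∃ g : Γ(E, V) →ₗ[Γ(X, V)] Γ(X, V), ∀ (hV : genericPoint X ∈ V) (m : Γ(E, V)),
      X.presheaf.germ V (genericPoint X) hV (g m) = φ (germ E hV m) := by
  by_cases hV : genericPoint X ∈ V
  · choose g hg using h hV
    exact ⟨{
      toFun := g
      map_add' := fun m n => ext_germ_genericPoint fun _ => by
        rw [map_add, hg, hg, hg, map_add, map_add]
      map_smul' := fun r m => ext_germ_genericPoint fun _ => by
        rw [RingHom.id_apply, smul_eq_mul, map_mul, hg, hg, germ_smul, map_smul, smul_eq_mul] },
      fun _ => hg⟩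
  · exact ⟨0, fun hV' => absurd hV' hV⟩

theorem exists_inducedForm_eq {U : X.Opens} (hU : genericPoint X ∈ U)
    {φ : Module.Dual X.functionField (genericStalk E)}
    (h : ∀ V ≤ U, ∀ (hV : genericPoint X ∈ V) (m : Γ(E, V)),
      ∃ r : Γ(X, V), X.presheaf.germ V (genericPoint X) hV r = φ (germ E hV m)) :
    ∃ s : Γ(dual E, U), inducedForm E hU s = φ := by
  choose g hg using fun V : {V : X.Opens // V ≤ U} => exists_linearMap_germ_eq_apply (h V.1 V.2)
  let s : DualSection E U := ⟨g, fun V W hWV m => ext_germ_genericPoint fun hW => by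
    rw [hg, germ_res, structureSheaf_germ_res, hg]⟩
  exact ⟨s, linearMap_ext_germ hU fun V hVU hV m =>
    (inducedForm_germ (E := E) (hU := hU) s hVU hV m).trans (hg ⟨V, hVU⟩ hV m)⟩

theorem exists_canonicalDualMap :
    ∃ c : genericStalk (dual E) →ₗ[X.functionField] Module.Dual X.functionField (genericStalk E),
      ∀ (U : X.Opens) (_ : U ≤ ⊤) (hU : genericPoint X ∈ U) (s : Γ(dual E, U)),
        c (germ (dual E) hU s) = inducedForm E hU s :=
  exists_linearMap_germ_eq (U := ⊤) trivial
    (fun _ _ hU => AddMonoidHom.mk' (inducedForm E hU) (inducedForm_add hU))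
    (fun _ _ _ hWV hW => inducedForm_res hWV hW) fun _ _ hU => inducedForm_smul hU

variable (E) in
/-- The canonical map `(E^∨)_η → (E_η)^∨`. -/
def canonicalDualMap :
    genericStalk (dual E) →ₗ[X.functionField] Module.Dual X.functionField (genericStalk E) :=
  exists_canonicalDualMap.choose

theorem canonicalDualMap_germ {U : X.Opens} (hU : genericPoint X ∈ U) (s : Γ(dual E, U)) :
    canonicalDualMap E (germ (dual E) hU s) = inducedForm E hU s :=
  exists_canonicalDualMap.choose_spec U le_top hU s

theorem canonicalDualMap_injective : Function.Injective (canonicalDualMap E) := by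
  intro ψ ψ' h
  obtain ⟨U, -, hU, s, t, rfl, rfl⟩ := exists_germ_eq₂ (U := ⊤) trivial ψ ψ'
  rw [canonicalDualMap_germ, canonicalDualMap_germ] at h
  rw [inducedForm_injective hU h]

end CanonicalDualMap

section Quasicoherent

theorem exists_pow_smul_eq_res {R : CommRingCat.{u}} (M : (Spec R).Modules) [M.IsQuasicoherent]
    (f : R) {W : (Spec R).Opens} (hW : W = PrimeSpectrum.basicOpen f) (s : Γ(M, W)) :
    ∃ (n : ℕ) (t : Γ(M, ⊤)),
      M.presheaf.map (homOfLE (le_top : W ≤ ⊤)).op t = (f ^ n : R) • s := by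
  subst hW
  obtain ⟨⟨t, ⟨_, n, rfl⟩⟩, ht⟩ := ((isIso_fromTildeΓ_iff_isLocalizing M).mp inferInstance f).surj s
  exact ⟨n, t, ht.symm⟩

variable {X : Scheme.{u}}

theorem fromSpec_appIso_inv {U : X.Opens} (hU : IsAffineOpen U) {W : (Spec Γ(X, U)).Opens}
    (h : hU.fromSpec ''ᵁ W ≤ U) (r : Γ(X, U)) :
    (hU.fromSpec.appIso W).inv ((Spec Γ(X, U)).presheaf.map W.leTop.op
      ((Scheme.ΓSpecIso Γ(X, U)).inv r)) = X.presheaf.map (homOfLE h).op r := by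
  have hW : W ≤ hU.fromSpec ⁻¹ᵁ U := hU.fromSpec_preimage_self ▸ le_top
  have happ : hU.fromSpec.appLE U W hW =
      (Scheme.ΓSpecIso Γ(X, U)).inv ≫ (Spec Γ(X, U)).presheaf.map W.leTop.op := by
    rw [Scheme.Hom.appLE, hU.fromSpec_app_self, Category.assoc, ← Functor.map_comp]
    rfl
  have hinv := Scheme.Hom.appLE_appIso_inv hU.fromSpec hW
  rw [happ] at hinv
  exact congrArg (fun g : Γ(X, U) ⟶ Γ(X, hU.fromSpec ''ᵁ W) => g r) hinv

theorem exists_pow_smul_eq_res_of_isAffineOpen (E : X.Modules) [E.IsQuasicoherent] {U V : X.Opens}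
    (hU : IsAffineOpen U) (f : Γ(X, U)) (hV : V = X.basicOpen f) (hVU : V ≤ U) (s : Γ(E, V)) :
    ∃ (n : ℕ) (t : Γ(E, U)),
      E.presheaf.map (homOfLE hVU).op t = X.presheaf.map (homOfLE hVU).op (f ^ n) • s := by
  let W : (Spec Γ(X, U)).Opens := PrimeSpectrum.basicOpen f
  obtain rfl : V = hU.fromSpec ''ᵁ W := hV.trans (hU.fromSpec_image_basicOpen f).symm
  obtain ⟨n, t, ht⟩ := exists_pow_smul_eq_res (E.restrict hU.fromSpec) f rfl s
  have hT : U = hU.fromSpec ''ᵁ ⊤ := by simp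
  refine ⟨n, E.presheaf.map (homOfLE hT.le).op t, ?_⟩
  rw [← fromSpec_appIso_inv hU hVU (f ^ n)]
  refine Eq.trans ?_ ht
  exact (congrArg (fun g : Γ(E, hU.fromSpec ''ᵁ ⊤) ⟶ Γ(E, hU.fromSpec ''ᵁ W) => g t)
    (E.presheaf.map_comp (homOfLE hT.le).op (homOfLE hVU).op)).symm

end Quasicoherent

section Stalks

variable {X : Scheme.{u}} [IsIntegral X] (E : X.Modules)

/-- The image of the stalk `E_x` in the generic stalk of `E`. -/
def stalkAt (x : X) : Submodule (regularAt x) (genericStalk E) where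
  carrier := {e | ∃ (U : X.Opens) (hx : x ∈ U) (m : Γ(E, U)), germ E (genericPoint_mem hx) m = e}
  zero_mem' := ⟨⊤, trivial, 0, map_zero _⟩
  add_mem' := by
    rintro _ _ ⟨U, hU, m, rfl⟩ ⟨V, hV, n, rfl⟩
    refine ⟨U ⊓ V, ⟨hU, hV⟩, E.presheaf.map (homOfLE inf_le_left).op m +
      E.presheaf.map (homOfLE inf_le_right).op n, ?_⟩
    rw [map_add, germ_res, germ_res]
  smul_mem' := by
    rintro ⟨f, hf⟩ _ ⟨V, hV, m, rfl⟩
    obtain ⟨U, hU, r, rfl⟩ := mem_regularAt_iff.mp hf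
    refine ⟨U ⊓ V, ⟨hU, hV⟩, X.presheaf.map (homOfLE (inf_le_left : U ⊓ V ≤ U)).op r •
      E.presheaf.map (homOfLE (inf_le_right : U ⊓ V ≤ V)).op m, ?_⟩
    rw [germ_smul, germ_res, structureSheaf_germ_res]
    rfl

/-- The linear forms on the generic stalk that take regular values on the stalk at `x`; for coherent
`E` this is the stalk at `x` of the dual sheaf, see `mem_stalkAt_dual_iff`. -/
def dualLattice (x : X) :
    Submodule (regularAt x) (Module.Dual X.functionField (genericStalk E)) where
  carrier := {φ | ∀ e ∈ stalkAt E x, φ e ∈ regularAt x}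
  zero_mem' _ _ := zero_mem _
  add_mem' hφ hψ e he := add_mem (hφ e he) (hψ e he)
  smul_mem' r _ hφ e he := mul_mem r.2 (hφ e he)

variable {E}

theorem mem_dualLattice {x : X} {φ : Module.Dual X.functionField (genericStalk E)} :
    φ ∈ dualLattice E x ↔ ∀ e ∈ stalkAt E x, φ e ∈ regularAt x :=
  Iff.rfl

theorem germ_mem_stalkAt {U : X.Opens} (hU : genericPoint X ∈ U) {x : X} (hx : x ∈ U)
    (m : Γ(E, U)) : germ E hU m ∈ stalkAt E x :=
  ⟨U, hx, m, rfl⟩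

theorem mem_stalkAt_genericPoint (e : genericStalk E) : e ∈ stalkAt E (genericPoint X) := by
  obtain ⟨U, -, hU, m, rfl⟩ := exists_germ_eq (U := ⊤) trivial e
  exact germ_mem_stalkAt hU hU m

theorem isOpen_setOf_mem_stalkAt (e : genericStalk E) : IsOpen {x : X | e ∈ stalkAt E x} := by
  refine isOpen_iff_forall_mem_open.mpr fun x hx => ?_
  obtain ⟨U, hxU, m, rfl⟩ := hx
  exact ⟨U, fun y hy => germ_mem_stalkAt _ hy m, U.isOpen, hxU⟩

theorem canonicalDualMap_mem_dualLattice {x : X} {ψ : genericStalk (dual E)}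
    (hψ : ψ ∈ stalkAt (dual E) x) : canonicalDualMap E ψ ∈ dualLattice E x := by
  obtain ⟨U, hU, s, rfl⟩ := hψ
  rintro _ ⟨V, hV, m, rfl⟩
  have hx : x ∈ U ⊓ V := ⟨hU, hV⟩
  have hη := genericPoint_mem hx
  rw [canonicalDualMap_germ, ← germ_res (inf_le_right : U ⊓ V ≤ V) hη,
    inducedForm_germ s inf_le_left hη]
  exact germ_mem_regularAt _ hx _

theorem flip_canonicalDualMap_mem_dualLattice {x : X} {e : genericStalk E}
    (he : e ∈ stalkAt E x) : (canonicalDualMap E).flip e ∈ dualLattice (dual E) x :=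
  mem_dualLattice.mpr fun _ hψ => canonicalDualMap_mem_dualLattice hψ e he

theorem mem_dualLattice_iff_of_eq_span {x : X} {S : Set (genericStalk E)}
    (hS : stalkAt E x = Submodule.span (regularAt x) S)
    {φ : Module.Dual X.functionField (genericStalk E)} :
    φ ∈ dualLattice E x ↔ ∀ e ∈ S, φ e ∈ regularAt x := by
  rw [mem_dualLattice, hS]
  refine ⟨fun h e he => h e (Submodule.subset_span he), fun h e he => ?_⟩
  induction he using Submodule.span_induction with
  | mem e he => exact h e he
  | zero => exact map_zero φ ▸ zero_mem _
  | add a b _ _ ha hb => exact map_add φ a b ▸ add_mem ha hb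
  | smul r a _ ha => exact map_smul φ r.1 a ▸ mul_mem r.2 ha

end Stalks

section Coherent

variable {X : Scheme.{u}} [IsIntegral X] {E : X.Modules}

theorem exists_smul_germ_eq_of_mem_stalkAt [E.IsQuasicoherent] {U : X.Opens} (hU : IsAffineOpen U)
    {x : X} (hxU : x ∈ U) {e : genericStalk E} (he : e ∈ stalkAt E x) :
    ∃ r ∈ regularAt x, ∃ t : Γ(E, U), r • germ E (genericPoint_mem hxU) t = e := by
  obtain ⟨V, hxV, m, rfl⟩ := he
  obtain ⟨f, hfV, hxf⟩ := hU.exists_basicOpen_le ⟨x, hxV⟩ hxU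
  have hη : genericPoint X ∈ X.basicOpen f := genericPoint_mem hxf
  obtain ⟨n, t, ht⟩ := exists_pow_smul_eq_res_of_isAffineOpen E hU f rfl (X.basicOpen_le f)
    (E.presheaf.map (homOfLE hfV).op m)
  have ht := congrArg (germ E hη) ht
  rw [germ_res, germ_smul, germ_res, structureSheaf_germ_res] at ht
  have hunit : IsUnit (X.presheaf.germ U x hxU (f ^ n)) := by
    rw [map_pow]
    exact ((X.mem_basicOpen f x hxU).mp hxf).pow n
  obtain ⟨b, hb⟩ := hunit.exists_left_inv
  refine ⟨algebraMap _ X.functionField b, ⟨b, rfl⟩, t, ?_⟩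
  rw [ht, ← algebraMap_germ hxU, ← mul_smul, ← map_mul, hb, map_one, one_smul]

theorem exists_smul_mem_stalkAt [E.IsQuasicoherent] (x : X) (e : genericStalk E) :
    ∃ r : X.functionField, r ≠ 0 ∧ r • e ∈ stalkAt E x := by
  obtain ⟨_, ⟨U, hU, rfl⟩, hxU, -⟩ :=
    X.isBasis_affineOpens.exists_subset_of_mem_open (Set.mem_univ x) isOpen_univ
  obtain ⟨r, -, t, rfl⟩ := exists_smul_germ_eq_of_mem_stalkAt hU (genericPoint_mem hxU)
    (mem_stalkAt_genericPoint e)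
  obtain rfl | hr := eq_or_ne r 0
  · exact ⟨1, one_ne_zero, by rw [zero_smul, smul_zero]; exact zero_mem _⟩
  · exact ⟨r⁻¹, inv_ne_zero hr, by
      rw [inv_smul_smul₀ hr]; exact germ_mem_stalkAt _ hxU t⟩

theorem exists_stalkAt_eq_span (hE : IsCoherent E) (x : X) :
    ∃ (U : X.Opens) (S : Finset (genericStalk E)), x ∈ U ∧
      ∀ y ∈ U, stalkAt E y = Submodule.span (regularAt y) (S : Set (genericStalk E)) := by
  classical
  have := hE.1
  obtain ⟨_, ⟨U, hU, rfl⟩, hxU, -⟩ :=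
    X.isBasis_affineOpens.exists_subset_of_mem_open (Set.mem_univ x) isOpen_univ
  have hη := genericPoint_mem hxU
  obtain ⟨T, hT⟩ := (hE.2 U hU).fg_top
  refine ⟨U, T.image (germ E hη), hxU, fun y hy => le_antisymm (fun e he => ?_) ?_⟩
  · obtain ⟨r, hr, t, rfl⟩ := exists_smul_germ_eq_of_mem_stalkAt hU hy he
    refine Submodule.smul_mem _ (⟨r, hr⟩ : regularAt y) ?_
    clear he
    have ht : t ∈ Submodule.span Γ(X, U) (T : Set Γ(E, U)) := hT ▸ Submodule.mem_top
    induction ht using Submodule.span_induction with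
    | mem m hm => exact Submodule.subset_span (Finset.mem_image_of_mem _ hm)
    | zero => exact map_zero (germ E hη) ▸ zero_mem _
    | add a b _ _ ha hb => exact map_add (germ E hη) a b ▸ add_mem ha hb
    | smul a m _ hm =>
      rw [germ_smul]
      exact Submodule.smul_mem _ (⟨_, germ_mem_regularAt hη hy a⟩ : regularAt y) hm
  · rw [Submodule.span_le, Finset.coe_image, Set.image_subset_iff]
    exact fun m _ => germ_mem_stalkAt hη hy m

theorem isOpen_setOf_mem_dualLattice (hE : IsCoherent E)
    (φ : Module.Dual X.functionField (genericStalk E)) : IsOpen {x : X | φ ∈ dualLattice E x} := by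
  refine isOpen_iff_forall_mem_open.mpr fun x hx => ?_
  obtain ⟨U, S, hxU, hS⟩ := exists_stalkAt_eq_span hE x
  refine ⟨U ∩ ⋂ e ∈ S, {y | φ e ∈ regularAt y}, fun y hy => ?_, U.isOpen.inter
    (isOpen_biInter_finset fun e _ => isOpen_setOf_mem_regularAt (φ e)), hxU, ?_⟩
  · exact (mem_dualLattice_iff_of_eq_span (hS y hy.1)).mpr (Set.mem_iInter₂.mp hy.2)
  · exact Set.mem_iInter₂.mpr ((mem_dualLattice_iff_of_eq_span (hS x hxU)).mp hx)

theorem exists_smul_mem_dualLattice (hE : IsCoherent E) (x : X)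
    (φ : Module.Dual X.functionField (genericStalk E)) :
    ∃ r : X.functionField, r ≠ 0 ∧ r • φ ∈ dualLattice E x := by
  classical
  obtain ⟨U, S, hxU, hS⟩ := exists_stalkAt_eq_span hE x
  obtain ⟨b, hb⟩ := IsLocalization.exist_integer_multiples_of_finset
    (nonZeroDivisors (X.presheaf.stalk x)) (S.image φ)
  refine ⟨algebraMap _ X.functionField b.1,
    IsFractionRing.to_map_ne_zero_of_mem_nonZeroDivisors b.2,
    (mem_dualLattice_iff_of_eq_span (hS x hxU)).mpr fun e he => ?_⟩
  obtain ⟨a, ha⟩ := hb _ (Finset.mem_image_of_mem _ he)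
  exact ⟨a, ha.trans (Algebra.smul_def _ _)⟩

theorem exists_mem_stalkAt_dual_canonicalDualMap_eq (hE : IsCoherent E) {x : X}
    {φ : Module.Dual X.functionField (genericStalk E)} (hφ : φ ∈ dualLattice E x) :
    ∃ ψ ∈ stalkAt (dual E) x, canonicalDualMap E ψ = φ := by
  let U : X.Opens := ⟨_, isOpen_setOf_mem_dualLattice hE φ⟩
  have hxU : x ∈ U := hφ
  obtain ⟨s, hs⟩ := exists_inducedForm_eq (genericPoint_mem hxU) fun V hVU hV m =>
    exists_germ_eq_of_forall_mem_regularAt hV fun y hy => hVU hy _ (germ_mem_stalkAt hV hy m)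
  exact ⟨_, germ_mem_stalkAt _ hxU s, (canonicalDualMap_germ _ s).trans hs⟩

theorem mem_stalkAt_dual_iff (hE : IsCoherent E) {x : X} {ψ : genericStalk (dual E)} :
    ψ ∈ stalkAt (dual E) x ↔ canonicalDualMap E ψ ∈ dualLattice E x := by
  refine ⟨canonicalDualMap_mem_dualLattice, fun h => ?_⟩
  obtain ⟨ψ', hψ', heq⟩ := exists_mem_stalkAt_dual_canonicalDualMap_eq hE h
  rwa [← canonicalDualMap_injective heq]

theorem canonicalDualMap_bijective (hE : IsCoherent E) :
    Function.Bijective (canonicalDualMap E) := by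
  refine ⟨canonicalDualMap_injective, fun φ => ?_⟩
  obtain ⟨ψ, -, hψ⟩ := exists_mem_stalkAt_dual_canonicalDualMap_eq hE (x := genericPoint X)
    (φ := φ) fun e _ => mem_regularAt_genericPoint (φ e)
  exact ⟨ψ, hψ⟩

end Coherent

section Hartogs

variable {X : Scheme.{u}} [IsIntegral X]

/-- Hartogs' property for a sheaf of modules: an element of the generic stalk which lies in the
stalks at all prime divisors of `U` is a section over `U`. -/
def IsDeterminedInCodimOne (F : X.Modules) : Prop :=
  ∀ (U : X.Opens) (hU : genericPoint X ∈ U) (e : genericStalk F),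
    (∀ P : PrimeDivisor X, P.1 ∈ U → e ∈ stalkAt F P.1) → e ∈ Set.range (germ F hU)

theorem flip_canonicalDualMap_injective {E : X.Modules} (hE : IsCoherent E) :
    Function.Injective (canonicalDualMap E).flip := by
  refine (injective_iff_map_eq_zero _).mpr fun e he => ?_
  refine (Module.forall_dual_apply_eq_zero_iff X.functionField e).mp fun φ => ?_
  obtain ⟨ψ, rfl⟩ := (canonicalDualMap_bijective hE).2 φ
  exact LinearMap.congr_fun he ψ

theorem inducedForm_toDoubleDual {E : X.Modules} {U : X.Opens} (hU : genericPoint X ∈ U)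
    (m : Γ(E, U)) :
    inducedForm (dual E) hU ((toDoubleDual E).app U m) =
      (canonicalDualMap E).flip (germ E hU m) :=
  linearMap_ext_germ hU fun V hVU hV t => by
    rw [inducedForm_germ _ hVU, LinearMap.flip_apply, canonicalDualMap_germ,
      ← germ_res hVU hV, inducedForm_germ t le_rfl]
    rfl

variable [IsLocallyNoetherian X] [∀ x : X, IsIntegrallyClosed (X.presheaf.stalk x)] {E : X.Modules}

theorem exists_inducedForm_eq_of_forall_primeDivisor {U : X.Opens} (hU : genericPoint X ∈ U)
    {φ : Module.Dual X.functionField (genericStalk E)}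
    (h : ∀ P : PrimeDivisor X, P.1 ∈ U → φ ∈ dualLattice E P.1) :
    ∃ s : Γ(dual E, U), inducedForm E hU s = φ :=
  exists_inducedForm_eq hU fun _ hVU hV m => exists_germ_eq_of_forall_primeDivisor hV fun P hP =>
    h P (hVU hP) _ (germ_mem_stalkAt hV hP m)

theorem isDeterminedInCodimOne_dual : IsDeterminedInCodimOne (dual E) := by
  intro U hU ψ h
  obtain ⟨s, hs⟩ := exists_inducedForm_eq_of_forall_primeDivisor hU fun P hP =>
    canonicalDualMap_mem_dualLattice (h P hP)
  exact ⟨s, canonicalDualMap_injective ((canonicalDualMap_germ hU s).trans hs)⟩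

theorem IsReflexive.isDeterminedInCodimOne (hE : IsCoherent E) (hrefl : IsReflexive E) :
    IsDeterminedInCodimOne E := by
  intro U hU e h
  obtain ⟨s, hs⟩ := exists_inducedForm_eq_of_forall_primeDivisor hU fun P hP =>
    flip_canonicalDualMap_mem_dualLattice (h P hP)
  have : IsIso (toDoubleDual E) := hrefl
  obtain ⟨m, rfl⟩ := (ConcreteCategory.bijective_of_isIso ((toDoubleDual E).app U)).2 s
  exact ⟨m, flip_canonicalDualMap_injective hE ((inducedForm_toDoubleDual hU m).symm.trans hs)⟩

end Hartogs

section Divisors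

theorem PrimeDivisor.eq_of_specializes {X : Scheme.{u}} {P Q : PrimeDivisor X} (h : Q.1 ⤳ P.1) :
    Q = P := by
  by_contra hne
  have hlt : P.1 < Q.1 := lt_of_le_not_ge h fun h' => hne (Subtype.ext (h.antisymm h').eq)
  have hle := Order.coheight_add_one_le hlt
  rw [P.2, Q.2] at hle
  exact absurd hle (by decide)

theorem exists_open_primeDivisor_notMem {X : Scheme.{u}} (P : PrimeDivisor X)
    {S : Set (PrimeDivisor X)} (hS : S.Finite) (hP : P ∉ S) :
    ∃ U : X.Opens, P.1 ∈ U ∧ ∀ Q ∈ S, Q.1 ∉ U := by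
  refine ⟨⟨(⋃ Q ∈ S, closure {Q.1})ᶜ,
    (hS.isClosed_biUnion fun Q _ => isClosed_closure).isOpen_compl⟩, fun h => ?_, fun Q hQ h =>
    h (Set.mem_iUnion₂.mpr ⟨Q, hQ, subset_closure rfl⟩)⟩
  obtain ⟨Q, hQ, hPQ⟩ := Set.mem_iUnion₂.mp h
  exact hP (PrimeDivisor.eq_of_specializes (specializes_iff_mem_closure.mpr hPQ) ▸ hQ)

variable {X : Scheme.{u}} [IsIntegral X]

theorem ord_one [IsLocallyNoetherian X] (x : X) : Scheme.ord (1 : X.functionField) x = 0 := by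
  have h := Scheme.ord_mul (X := X) (x := x) (one_ne_zero (α := X.functionField)) one_ne_zero
  rwa [mul_one, left_eq_add] at h

theorem ord_inv [IsLocallyNoetherian X] {f : X.functionField} (hf : f ≠ 0) (x : X) :
    Scheme.ord f⁻¹ x = -Scheme.ord f x := by
  have h := Scheme.ord_mul (x := x) hf (inv_ne_zero hf)
  rw [mul_inv_cancel₀ hf, ord_one] at h
  exact eq_neg_of_add_eq_zero_right h.symm

theorem exists_mem_iff_ord_nonneg [IsLocallyNoetherian X] (P : PrimeDivisor X)
    [IsDiscreteValuationRing (X.presheaf.stalk P.1)]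
    {I : Submodule (regularAt P.1) X.functionField} {r q : X.functionField} (hr : r ≠ 0)
    (hrI : r ∈ I) (hq : q ≠ 0) (hqI : ∀ f ∈ I, q * f ∈ regularAt P.1) :
    ∃ n : ℤ, ∀ f : X.functionField, f ≠ 0 → (f ∈ I ↔ 0 ≤ n + Scheme.ord f P.1) := by
  have hbdd : ∀ n : ℤ, (∃ f ∈ I, f ≠ 0 ∧ Scheme.ord f P.1 = n) → -Scheme.ord q P.1 ≤ n := by
    rintro _ ⟨f, hfI, hf, rfl⟩
    have h := hqI f hfI
    rw [mem_regularAt_iff_ord_nonneg P (mul_ne_zero hq hf), Scheme.ord_mul hq hf] at h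
    linarith
  obtain ⟨n, ⟨g, hgI, hg, rfl⟩, hmin⟩ :=
    Int.exists_least_of_bdd ⟨_, hbdd⟩ ⟨_, r, hrI, hr, rfl⟩
  refine ⟨-Scheme.ord g P.1, fun f hf => ⟨fun h => ?_, fun h => ?_⟩⟩
  · linarith [hmin _ ⟨f, h, hf, rfl⟩]
  · have hfg : f * g⁻¹ ∈ regularAt P.1 := by
      rw [mem_regularAt_iff_ord_nonneg P (mul_ne_zero hf (inv_ne_zero hg)),
        Scheme.ord_mul hf (inv_ne_zero hg), ord_inv hg]
      linarith
    have hfgI := I.smul_mem (⟨_, hfg⟩ : regularAt P.1) hgI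
    rwa [Subring.smul_def, smul_eq_mul, inv_mul_cancel_right₀ hg] at hfgI

variable {F : X.Modules} {e : genericStalk F}

theorem smul_mem_stalkAt_iff_mem_regularAt {x : X} (he : e ∈ stalkAt F x)
    {φ : Module.Dual X.functionField (genericStalk F)} (hφ : φ ∈ dualLattice F x) (h : φ e = 1)
    {f : X.functionField} : f • e ∈ stalkAt F x ↔ f ∈ regularAt x := by
  refine ⟨fun hf => ?_, fun hf => (stalkAt F x).smul_mem (⟨f, hf⟩ : regularAt x) he⟩
  have hfe := hφ _ hf
  rwa [map_smul, h, smul_eq_mul, mul_one] at hfe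

theorem exists_smul_mem_stalkAt_iff [IsLocallyNoetherian X] (P : PrimeDivisor X)
    [IsDiscreteValuationRing (X.presheaf.stalk P.1)]
    {φ : Module.Dual X.functionField (genericStalk F)} (h : φ e = 1)
    (he : ∃ r : X.functionField, r ≠ 0 ∧ r • e ∈ stalkAt F P.1)
    (hφ : ∃ q : X.functionField, q ≠ 0 ∧ q • φ ∈ dualLattice F P.1) :
    ∃ n : ℤ, ∀ f : X.functionField, f ≠ 0 →
      (f • e ∈ stalkAt F P.1 ↔ 0 ≤ n + Scheme.ord f P.1) := by
  obtain ⟨r, hr, hre⟩ := he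
  obtain ⟨q, hq, hqφ⟩ := hφ
  refine exists_mem_iff_ord_nonneg P (I := (stalkAt F P.1).comap
    ((LinearMap.toSpanSingleton X.functionField (genericStalk F) e).restrictScalars _))
    hr hre hq fun f hf => ?_
  have hqf := hqφ _ hf
  rwa [LinearMap.restrictScalars_apply, LinearMap.toSpanSingleton_apply, LinearMap.smul_apply,
    map_smul, h, smul_eq_mul, smul_eq_mul, mul_one] at hqf

variable [IsNoetherian X] {D D' : WeilDivisor X}

theorem div_apply (f : X.functionField) (P : PrimeDivisor X) : div f P = Scheme.ord f P.1 :=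
  rfl

theorem IsDivisorOf.smul_mem_stalkAt_iff (hD : IsDivisorOf F e D) (P : PrimeDivisor X)
    {f : X.functionField} (hf : f ≠ 0) : f • e ∈ stalkAt F P.1 ↔ 0 ≤ D P + Scheme.ord f P.1 := by
  constructor
  · rintro ⟨U, hPU, m, hm⟩
    have hfU : f ∈ sectionsOfDivisor D U := (hD U (genericPoint_mem hPU)).symm ▸ ⟨m, hm⟩
    exact hfU hf P hPU
  · intro h
    have hfin : {Q | (D + div f) Q < 0}.Finite :=
      (D + div f).support.finite_toSet.subset fun _ hQ => Finsupp.mem_support_iff.mpr hQ.ne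
    obtain ⟨U, hPU, hU⟩ := exists_open_primeDivisor_notMem P hfin h.not_gt
    have hfU : f ∈ sectionsOfDivisor D U := fun _ Q hQ => not_lt.mp fun hlt => hU Q hlt hQ
    rw [hD U (genericPoint_mem hPU)] at hfU
    obtain ⟨m, hm⟩ := hfU
    exact ⟨U, hPU, m, hm⟩

theorem IsDivisorOf.mem_stalkAt_iff (hD : IsDivisorOf F e D) (P : PrimeDivisor X) :
    e ∈ stalkAt F P.1 ↔ 0 ≤ D P := by
  have h := hD.smul_mem_stalkAt_iff P one_ne_zero
  rwa [one_smul, ord_one, add_zero] at h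

theorem IsDivisorOf.le [∀ P : PrimeDivisor X, IsDiscreteValuationRing (X.presheaf.stalk P.1)]
    (hD : IsDivisorOf F e D) (hD' : IsDivisorOf F e D') : D ≤ D' := by
  intro P
  obtain ⟨f, hf, hfP⟩ := exists_ord_eq P (-D P)
  have h := (hD'.smul_mem_stalkAt_iff P hf).mp ((hD.smul_mem_stalkAt_iff P hf).mpr (by omega))
  omega

theorem IsDivisorOf.unique [∀ P : PrimeDivisor X, IsDiscreteValuationRing (X.presheaf.stalk P.1)]
    (hD : IsDivisorOf F e D) (hD' : IsDivisorOf F e D') : D = D' :=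
  le_antisymm (hD.le hD') (hD'.le hD)

theorem IsDeterminedInCodimOne.isDivisorOf (hF : IsDeterminedInCodimOne F)
    (h : ∀ (P : PrimeDivisor X) (f : X.functionField), f ≠ 0 →
      (f • e ∈ stalkAt F P.1 ↔ 0 ≤ D P + Scheme.ord f P.1)) : IsDivisorOf F e D := by
  refine fun U hU => Set.ext fun f => ⟨fun hfU => ?_, fun ⟨m, hm⟩ hf P hP =>
    (h P f hf).mp (hm ▸ germ_mem_stalkAt hU hP m)⟩
  obtain rfl | hf := eq_or_ne f 0
  · exact ⟨0, by rw [map_zero, zero_smul]⟩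
  · exact hF U hU _ fun P hP => (h P f hf).mpr (hfU hf P hP)

open Filter Topology in
theorem IsDeterminedInCodimOne.exists_isDivisorOf
    [∀ P : PrimeDivisor X, IsDiscreteValuationRing (X.presheaf.stalk P.1)]
    (hF : IsDeterminedInCodimOne F) {φ : Module.Dual X.functionField (genericStalk F)}
    (h : φ e = 1) (he : ∀ P : PrimeDivisor X, ∃ r : X.functionField, r ≠ 0 ∧ r • e ∈ stalkAt F P.1)
    (hφ : ∀ P : PrimeDivisor X, ∃ q : X.functionField, q ≠ 0 ∧ q • φ ∈ dualLattice F P.1)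
    (hφη : ∀ᶠ x in 𝓝 (genericPoint X), φ ∈ dualLattice F x) : ∃ D, IsDivisorOf F e D := by
  choose n hn using fun P => exists_smul_mem_stalkAt_iff P h (he P) (hφ P)
  have heη : ∀ᶠ x in 𝓝 (genericPoint X), e ∈ stalkAt F x :=
    (isOpen_setOf_mem_stalkAt e).mem_nhds (mem_stalkAt_genericPoint e)
  obtain ⟨V, hV, hVo, hηV⟩ := eventually_nhds_iff.mp (heη.and hφη)
  let U : X.Opens := ⟨V, hVo⟩
  have hn0 : ∀ P : PrimeDivisor X, P.1 ∈ U → n P = 0 := by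
    intro P hP
    have hreg : ∀ f : X.functionField, f ≠ 0 →
        (0 ≤ Scheme.ord f P.1 ↔ 0 ≤ n P + Scheme.ord f P.1) := fun f hf => by
      rw [← mem_regularAt_iff_ord_nonneg P hf, ← hn P f hf,
        smul_mem_stalkAt_iff_mem_regularAt (hV _ hP).1 (hV _ hP).2 h]
    obtain ⟨f, hf, hfP⟩ := exists_ord_eq P 0
    obtain ⟨g, hg, hgP⟩ := exists_ord_eq P (-n P)
    have := hreg f hf
    have := hreg g hg
    omega
  have hfin : (Function.support n).Finite :=
    (finite_primeDivisor_not_mem U ⟨_, hηV⟩).subset fun P hP hPU => hP (hn0 P hPU)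
  exact ⟨Finsupp.ofSupportFinite n hfin, hF.isDivisorOf hn⟩

theorem divisorOf_spec (h : ∃ D, IsDivisorOf F e D) : IsDivisorOf F e (divisorOf F e) :=
  Classical.epsilon_spec h

end Divisors

section Existence

variable {X : Scheme.{u}} [IsIntegral X] [IsNoetherian X]
  [∀ x : X, IsIntegrallyClosed (X.presheaf.stalk x)] {E : X.Modules}

theorem IsReflexive.existsUnique_isDivisorOf (hE : IsCoherent E) (hrefl : IsReflexive E)
    {e : genericStalk E} (he : e ≠ 0) : ∃! D, IsDivisorOf E e D := by
  have := hE.1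
  obtain ⟨φ, hφ⟩ := Module.Projective.exists_dual_eq_one X.functionField he
  exact existsUnique_of_exists_of_unique ((hrefl.isDeterminedInCodimOne hE).exists_isDivisorOf hφ
    (fun P => exists_smul_mem_stalkAt P.1 e) (fun P => exists_smul_mem_dualLattice hE P.1 φ)
    ((isOpen_setOf_mem_dualLattice hE φ).mem_nhds fun v _ => mem_regularAt_genericPoint (φ v)))
    fun _ _ => IsDivisorOf.unique

theorem IsCoherent.existsUnique_isDivisorOf_dual (hE : IsCoherent E) {ψ : genericStalk (dual E)}
    (hψ : ψ ≠ 0) : ∃! D, IsDivisorOf (dual E) ψ D := by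
  have := hE.1
  obtain ⟨e, he⟩ : ∃ e, canonicalDualMap E ψ e = 1 :=
    LinearMap.surjective ((map_ne_zero_iff _ canonicalDualMap_injective).mpr hψ) 1
  refine existsUnique_of_exists_of_unique (isDeterminedInCodimOne_dual.exists_isDivisorOf
    (φ := (canonicalDualMap E).flip e) he (fun P => ?_) (fun P => ?_) ?_)
    fun _ _ => IsDivisorOf.unique
  · obtain ⟨r, hr, hrψ⟩ := exists_smul_mem_dualLattice hE P.1 (canonicalDualMap E ψ)
    exact ⟨r, hr, (mem_stalkAt_dual_iff hE).mpr ((map_smul (canonicalDualMap E) r ψ).symm ▸ hrψ)⟩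
  · obtain ⟨r, hr, hre⟩ := exists_smul_mem_stalkAt P.1 e
    exact ⟨r, hr, map_smul (canonicalDualMap E).flip r e ▸
      flip_canonicalDualMap_mem_dualLattice hre⟩
  · filter_upwards [(isOpen_setOf_mem_stalkAt e).mem_nhds (mem_stalkAt_genericPoint e)] with x hx
    exact flip_canonicalDualMap_mem_dualLattice hx

end Existence

section Duality

variable {X : Scheme.{u}} [IsIntegral X] [IsNoetherian X] {E : X.Modules}

theorem divTop_of_ne_zero {f : X.functionField} (hf : f ≠ 0) : divTop f = (div f : WeilDivisor X) :=
  if_neg hf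

theorem weilDecoration_of_ne_zero {e : genericStalk E} (he : e ≠ 0) :
    weilDecoration E e = (divisorOf E e : WeilDivisor X) :=
  if_neg he

theorem coe_mem_lowerBounds_dualDifferences_iff {B : WeilDivisor X}
    {φ : Module.Dual X.functionField (genericStalk E)} :
    (B : WithTop (WeilDivisor X)) ∈ lowerBounds (dualDifferences E φ) ↔
      ∀ v, φ v ≠ 0 → B ≤ div (φ v) - divisorOf E v := by
  constructor
  · intro h v hv
    rw [← WithTop.coe_le_coe, sub_eq_add_neg, WithTop.coe_add, ← divTop_of_ne_zero hv]
    exact h ⟨v, fun hv0 => hv (hv0 ▸ map_zero φ), rfl⟩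
  · rintro h _ ⟨v, -, rfl⟩
    obtain hv | hv := eq_or_ne (φ v) 0
    · rw [divTop, if_pos hv, WithTop.top_add]
      exact le_top
    · rw [divTop_of_ne_zero hv, ← WithTop.coe_add, ← sub_eq_add_neg, WithTop.coe_le_coe]
      exact h v hv

theorem top_mem_lowerBounds_dualDifferences_iff {φ : Module.Dual X.functionField (genericStalk E)} :
    ⊤ ∈ lowerBounds (dualDifferences E φ) ↔ φ = 0 := by
  constructor
  · refine fun h => LinearMap.ext fun v => by_contra fun hv => ?_
    have hle := h ⟨v, fun hv0 => hv (hv0 ▸ map_zero φ), rfl⟩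
    rw [divTop_of_ne_zero hv, ← WithTop.coe_add, top_le_iff] at hle
    exact WithTop.coe_ne_top hle
  · rintro rfl _ ⟨v, -, rfl⟩
    rw [LinearMap.zero_apply, divTop, if_pos rfl, WithTop.top_add]

variable [∀ P : PrimeDivisor X, IsDiscreteValuationRing (X.presheaf.stalk P.1)]

theorem mem_dualLattice_iff_le_ord {W : genericStalk E → WeilDivisor X}
    (hW : ∀ v, v ≠ 0 → IsDivisorOf E v (W v)) (P : PrimeDivisor X)
    {φ : Module.Dual X.functionField (genericStalk E)} :
    φ ∈ dualLattice E P.1 ↔ ∀ v, φ v ≠ 0 → W v P ≤ Scheme.ord (φ v) P.1 := by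
  have hne {v : genericStalk E} (hv : φ v ≠ 0) : v ≠ 0 := fun hv0 => hv (hv0 ▸ map_zero φ)
  refine ⟨fun h v hv => ?_, fun h v hvP => ?_⟩
  · obtain ⟨g, hg, hgP⟩ := exists_ord_eq P (-W v P)
    have hgv := h _ (((hW v (hne hv)).smul_mem_stalkAt_iff P hg).mpr (by omega))
    rw [map_smul, smul_eq_mul, mem_regularAt_iff_ord_nonneg P (mul_ne_zero hg hv),
      Scheme.ord_mul hg hv] at hgv
    omega
  · obtain hv | hv := eq_or_ne (φ v) 0
    · exact hv ▸ zero_mem _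
    · exact (mem_regularAt_iff_ord_nonneg P hv).mpr
        ((((hW v (hne hv)).mem_stalkAt_iff P).mp hvP).trans (h v hv))

theorem IsDivisorOf.le_apply_iff_of_dual (hE : IsCoherent E) {W : genericStalk E → WeilDivisor X}
    (hW : ∀ v, v ≠ 0 → IsDivisorOf E v (W v)) {ψ : genericStalk (dual E)} {D : WeilDivisor X}
    (hD : IsDivisorOf (dual E) ψ D) (P : PrimeDivisor X) (n : ℤ) :
    n ≤ D P ↔ ∀ v, canonicalDualMap E ψ v ≠ 0 → n ≤ (div (canonicalDualMap E ψ v) - W v) P := by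
  obtain ⟨f, hf, hfP⟩ := exists_ord_eq P (-n)
  calc n ≤ D P ↔ f • ψ ∈ stalkAt (dual E) P.1 := by
        rw [hD.smul_mem_stalkAt_iff P hf]; omega
    _ ↔ f • canonicalDualMap E ψ ∈ dualLattice E P.1 := by
        rw [mem_stalkAt_dual_iff hE, map_smul]
    _ ↔ _ := by
        rw [mem_dualLattice_iff_le_ord hW]
        refine forall_congr' fun v => ?_
        rw [LinearMap.smul_apply, smul_eq_mul, mul_ne_zero_iff_left hf]
        refine forall_congr' fun hv => ?_
        rw [Scheme.ord_mul hf hv, Finsupp.sub_apply, div_apply]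
        omega

theorem IsDivisorOf.isLeast_of_dual (hE : IsCoherent E) {W : genericStalk E → WeilDivisor X}
    (hW : ∀ v, v ≠ 0 → IsDivisorOf E v (W v)) {ψ : genericStalk (dual E)} {D : WeilDivisor X}
    (hD : IsDivisorOf (dual E) ψ D) (P : PrimeDivisor X) :
    IsLeast {n : ℤ | ∃ v, canonicalDualMap E ψ v ≠ 0 ∧
      n = (div (canonicalDualMap E ψ v) - W v) P} (D P) := by
  have hglb : IsGLB {n : ℤ | ∃ v, canonicalDualMap E ψ v ≠ 0 ∧
      n = (div (canonicalDualMap E ψ v) - W v) P} (D P) := by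
    refine isGLB_iff_le_iff.mpr fun n => (hD.le_apply_iff_of_dual hE hW P n).trans
      ⟨?_, fun h v hv => h ⟨v, hv, rfl⟩⟩
    rintro h _ ⟨v, hv, rfl⟩
    exact h v hv
  exact ⟨hglb.mem_of_nonempty_of_not_isPredLimit hglb.nonempty
    Order.not_isPredLimit_of_isPredArchimedean, hglb.1⟩

theorem IsDivisorOf.isGLB_dualDifferences (hE : IsCoherent E)
    (hW : ∀ v : genericStalk E, v ≠ 0 → IsDivisorOf E v (divisorOf E v))
    {ψ : genericStalk (dual E)} (hψ : ψ ≠ 0) {D : WeilDivisor X} (hD : IsDivisorOf (dual E) ψ D) :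
    IsGLB (dualDifferences E (canonicalDualMap E ψ)) (D : WithTop (WeilDivisor X)) := by
  refine isGLB_iff_le_iff.mpr fun B => ?_
  induction B using WithTop.recTopCoe with
  | top =>
    rw [top_mem_lowerBounds_dualDifferences_iff, map_eq_zero_iff _ canonicalDualMap_injective]
    exact iff_of_false (by simp) hψ
  | coe B =>
    rw [WithTop.coe_le_coe, coe_mem_lowerBounds_dualDifferences_iff]
    exact (forall_congr' fun P => hD.le_apply_iff_of_dual hE hW P (B P)).trans
      ⟨fun h v hv P => h P v hv, fun h P v hv => h v hv P⟩

theorem isGLB_weilDecoration_dual (hE : IsCoherent E)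
    (hW : ∀ v : genericStalk E, v ≠ 0 → IsDivisorOf E v (divisorOf E v))
    {ψ : genericStalk (dual E)}
    (hD : ψ ≠ 0 → IsDivisorOf (dual E) ψ (divisorOf (dual E) ψ)) :
    IsGLB (dualDifferences E (canonicalDualMap E ψ)) (weilDecoration (dual E) ψ) := by
  by_cases hψ : ψ = 0
  · rw [weilDecoration, if_pos hψ]
    exact ⟨top_mem_lowerBounds_dualDifferences_iff.mpr (hψ ▸ map_zero _), fun _ _ => le_top⟩
  · rw [weilDecoration_of_ne_zero hψ]
    exact (hD hψ).isGLB_dualDifferences hE hW hψ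

end Duality

section CanonicalDualIso

variable {X : Scheme.{u}} [IsIntegral X] {E : X.Modules}

/-- The canonical isomorphism `(E^∨)_η ≅ (E_η)^∨` for a coherent sheaf `E`. -/
def canonicalDualIso (hE : IsCoherent E) :
    genericStalk (dual E) ≃ₗ[X.functionField] Module.Dual X.functionField (genericStalk E) :=
  LinearEquiv.ofBijective (canonicalDualMap E) (canonicalDualMap_bijective hE)

theorem isCanonicalDualIso_canonicalDualIso (hE : IsCoherent E) :
    IsCanonicalDualIso E (canonicalDualIso hE) := fun _ _ hU hV h s m =>
  (LinearMap.congr_fun (canonicalDualMap_germ hU s) _).trans (inducedForm_germ s h hV m)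

end CanonicalDualIso

end

end WeilDeco

theorem mainTheorem6_general (X : Scheme.{u}) [IsIntegral X] [IsNoetherian X]
    [∀ x : X, IsIntegrallyClosed (X.presheaf.stalk x)] (E : X.Modules) (hcoh : IsCoherent E)
    (hrefl : IsReflexive E) :
    (∀ e : genericStalk E, e ≠ 0 → ∃! D, IsDivisorOf E e D) ∧
    (∀ e : genericStalk (dual E), e ≠ 0 → ∃! D, IsDivisorOf (dual E) e D) ∧
    ∃ c : genericStalk (dual E) ≃ₗ[X.functionField] Module.Dual X.functionField (genericStalk E),
      IsCanonicalDualIso E c ∧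
      (∀ φ : Module.Dual X.functionField (genericStalk E),
        IsGLB (dualDifferences E φ) (weilDecoration (dual E) (c.symm φ))) ∧
      (∀ φ : Module.Dual X.functionField (genericStalk E), φ ≠ 0 →
        ∃ D : WeilDivisor X, weilDecoration (dual E) (c.symm φ) = D ∧
          ∀ P : PrimeDivisor X,
            IsLeast {n : ℤ | ∃ v : genericStalk E, φ v ≠ 0 ∧
              n = (div (φ v) - divisorOf E v) P} (D P)) := by
  have hdiv : ∀ e : genericStalk E, e ≠ 0 → ∃! D, IsDivisorOf E e D :=
    fun _ => hrefl.existsUnique_isDivisorOf hcoh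
  have hdual : ∀ ψ : genericStalk (dual E), ψ ≠ 0 → ∃! D, IsDivisorOf (dual E) ψ D :=
    fun _ => hcoh.existsUnique_isDivisorOf_dual
  have hW (e : genericStalk E) (he : e ≠ 0) := divisorOf_spec (hdiv e he).exists
  have hD (ψ : genericStalk (dual E)) (hψ : ψ ≠ 0) := divisorOf_spec (hdual ψ hψ).exists
  refine ⟨hdiv, hdual, canonicalDualIso hcoh, isCanonicalDualIso_canonicalDualIso hcoh,
    (canonicalDualIso hcoh).surjective.forall.mpr fun ψ => ?_,
    (canonicalDualIso hcoh).surjective.forall.mpr fun ψ hψ => ?_⟩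
  · rw [LinearEquiv.symm_apply_apply]
    exact isGLB_weilDecoration_dual hcoh hW (hD ψ)
  · rw [map_ne_zero_iff _ (canonicalDualIso hcoh).injective] at hψ
    rw [LinearEquiv.symm_apply_apply]
    exact ⟨_, weilDecoration_of_ne_zero hψ, (hD ψ hψ).isLeast_of_dual hcoh hW⟩

theorem mainTheorem6 {k : Type u} [Field k] [IsAlgClosed k] [CharZero k] (X : NormalVariety k)
    (E : X.X.Modules) (hcoh : IsCoherent E) (hrefl : IsReflexive E) :
    -- the Weil decorations of `E` and of `E^∨` are well defined
    (∀ e : genericStalk E, e ≠ 0 → ∃! D, IsDivisorOf E e D) ∧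
    (∀ e : genericStalk (dual E), e ≠ 0 → ∃! D, IsDivisorOf (dual E) e D) ∧
    -- under the canonical isomorphism `(E^∨)_η ≅ (E_η)^∨`, `W_{E^∨}(φ)` is the meet
    ∃ c : genericStalk (dual E) ≃ₗ[X.X.functionField]
        Module.Dual X.X.functionField (genericStalk E),
      IsCanonicalDualIso E c ∧
      (∀ φ : Module.Dual X.X.functionField (genericStalk E),
        IsGLB (dualDifferences E φ) (weilDecoration (dual E) (c.symm φ))) ∧
      -- and for `φ ≠ 0` this meet is a divisor, taken coefficientwise
      (∀ φ : Module.Dual X.X.functionField (genericStalk E), φ ≠ 0 →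
        ∃ D : WeilDivisor X.X, weilDecoration (dual E) (c.symm φ) = D ∧
          ∀ P : PrimeDivisor X.X,
            IsLeast {n : ℤ | ∃ v : genericStalk E, φ v ≠ 0 ∧
              n = (div (φ v) - divisorOf E v) P} (D P)) := by
  have := X.isIntegrallyClosed_stalk
  exact mainTheorem6_general X.X E hcoh hrefl
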